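/- Let $[0,1]$ and $[0,1]^2$ carry Lebesgue measure, let $p>2$ be a real number, let $k\ge 2$ be an integer, and let $U\in L^p([0,1]^2)$ be real valued and symmetric, i.e. $U(x,y)=U(y,x)$ for almost every $(x,y)$. Let $X_1,\dots,X_k$ be independent random variables, each uniformly distributed on $[0,1]$. Let $\mathcal U_X$ be the random step function on $[0,1]^2$ with $k$ uniform steps of length $1/k$ in each variable which takes the value $U(X_i,X_j)$ on the product of the $i$-th and the $j$-th step if $i\ne j$, and the value $0$ if $i=j$. For an integrable function $W$ on $[0,1]^2$ let $$\|W\|_\square=\sup_{S,T\subseteq[0,1]\text{ measurable}}\left|\int_{S\times T}W(x,y)\,dx\,dy\right|$$ be its cut norm, and let $\|\cdot\|_q$ denote the norm of $L^q([0,1]^2)$. (1) For every $\varphi>0$, with probability at least $1-3k^{-\varphi p}$, $$\|\mathcal U_X\|_\square-\|U\|_\square\le\left(30\|U\|_p+6\sqrt{\tfrac{\varphi p}{2}}\,\bigl(\|U\|_1+2\|U\|_p\bigr)\frac{\sqrt{\ln k}}{k^{\frac{p-3}{4p}-\varphi}}\right)k^{-\frac14+\frac1{4p}}.$$ (2) For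 every $\gamma\in(1/p,1/2)$, with probability at least $1-3k^{1-\gamma p}$, $$\|\mathcal U_X\|_\square-\|U\|_\square\ge-\left(\|U\|_\square+\sqrt{18(\gamma p-1)}\,\bigl(\|U\|_1+2\|U\|_p\bigr)\right)k^{-\frac12+\gamma}\sqrt{\ln k}.$$ -/

import Mathlib

noncomputable section

namespace CutSampling

open MeasureTheory

/-- The `L^q` norm `‖U‖_q` of a function on the unit square with Lebesgue measure,
for a real exponent `q`, as a real number. -/
def normL (q : ℝ) (U : unitInterval × unitInterval → ℝ) : ℝ :=
  (eLpNorm U (ENNReal.ofReal q) volume).toReal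

/-- The cut norm of an integrable function on the unit square: the supremum of
`|∫_{S × T} W|` over all measurable `S, T ⊆ [0,1]`. -/
def cutNorm (W : unitInterval × unitInterval → ℝ) : ℝ :=
  sSup {r : ℝ | ∃ S T : Set unitInterval, MeasurableSet S ∧ MeasurableSet T ∧
    r = |∫ z in S ×ˢ T, W z|}

/-- The `i`-th of the `k` steps of length `1/k` of the unit interval, with steps numbered from `0`.
(The point `1`, which forms a null set, belongs to no step.) -/
def step (k : ℕ) (i : Fin k) : Set unitInterval :=
  {x | (i : ℝ) / k ≤ (x : ℝ) ∧ (x : ℝ) < ((i : ℝ) + 1) / k}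

open Classical in
/-- The step function `U[x]` on the unit square given by the sample points `x 0, …, x (k-1)`: its
value on the product of steps `i` and `j` is `U (x i, x j)` if `i ≠ j`, and `0` if `i = j`. -/
def sampleKernel {k : ℕ} (U : unitInterval × unitInterval → ℝ) (x : Fin k → unitInterval) :
    unitInterval × unitInterval → ℝ :=
  fun z => ∑ i : Fin k, ∑ j : Fin k,
    if i ≠ j ∧ z.1 ∈ step k i ∧ z.2 ∈ step k j then U (x i, x j) else 0

end CutSampling

end

/-!
The cut norm of the step function of a sample is the cut norm of the matrix `U (x i, x j)` with zero
diagonal, divided by `k ^ 2` (`cutNorm_sampleKernel`), because a bilinear form on a cube is extremal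
at vertices. After `U` is replaced by an everywhere symmetric measurable version, all estimates are
about this matrix under a product measure.

*Mean, from above.* Let `|V| ≤ M`. For a set `S` of rows, the best set of columns consists of those in
which the sum over `S` is positive. These signs are estimated from about `√k` random rows
(`sum_sum_le_integral_guidedSum`), with an error of relative size `M * k ^ (-1 / 4)`. Hence only about
`2 ^ √k` sets of columns matter. Conditionally on the sampled rows each of them is given by a fixed
measurable set, for which the sum of the positive parts of the row sums has mean at most the cut norm
of `V`, up to a small error, and concentrates by McDiarmid's inequality, so that the maximum of these
sums is controlled as well (`integral_sup'_rowPlus_le`, `integral_matrixCut_le_of_bounded`). Truncation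
of `U` at the level `‖U‖_p * k ^ (1 / (4 * p))` gives the mean bound for `L^p` kernels
(`integral_matrixCut_le`).

*Concentration.* The cut norm of the sample has no bounded differences, since rows may be large.
The truncated cut norm `truncCut` admits only rectangles inside principal submatrices all of whose
absolute row sums are at most `c`. It has differences at most `2 * c`, is at most the cut norm, and
equals it if no row sum exceeds `c`. The normalized row sums are bounded in `L^p` by `‖U‖_p`, so for
`c = k ^ (1 + γ) * ‖U‖_p` some row sum exceeds `c` with probability at most `k ^ (1 - γ * p)`. The upper
tail follows, with `γ = φ + 1 / p` (`measureReal_matrixCut_ge_le`).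

*Lower bound.* The lower tail of the cut norm is at most that of the truncated one
(`measureReal_matrixCut_le_le`). The mean of the latter is at least the mean of the sum over the
rectangle of sample points in a fixed `A × D`, less the mean of the large row sums, which the `L^p`
bound makes negligible (`le_integral_truncCut`).
-/

noncomputable section

namespace CutSampling

open MeasureTheory ProbabilityTheory

/-! ### Product measures, McDiarmid's inequality and second moments -/

theorem integrable_of_abs_le {β : Type*} [MeasurableSpace β] {ρ : Measure β} [IsFiniteMeasure ρ]
    {f : β → ℝ} (hf : Measurable f) {C : ℝ} (hC : ∀ x, |f x| ≤ C) : Integrable f ρ :=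
  Integrable.of_bound hf.aestronglyMeasurable C (.of_forall hC)

theorem le_add_card_mul_of_bounded_diff {ι α : Type*} [Fintype ι] [DecidableEq ι]
    {f : (ι → α) → ℝ} {c : ℝ} (hd : ∀ x i a, f (Function.update x i a) ≤ f x + c) (x y : ι → α) :
    f x ≤ f y + Fintype.card ι * c := by
  have key : ∀ s : Finset ι, f (s.piecewise x y) ≤ f y + s.card * c := by
    intro s
    induction s using Finset.induction_on with
    | empty => simp
    | insert i s hi ih =>
      rw [Finset.piecewise_insert, Finset.card_insert_of_notMem hi]
      push_cast
      linarith [hd (s.piecewise x y) i (x i)]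
  simpa using key Finset.univ

theorem abs_le_of_bounded_diff {ι α : Type*} [Fintype ι] [DecidableEq ι]
    {f : (ι → α) → ℝ} {c : ℝ} (hd : ∀ x i a, f (Function.update x i a) ≤ f x + c) (y : ι → α)
    (x : ι → α) : |f x| ≤ |f y| + Fintype.card ι * c := by
  have h1 := le_add_card_mul_of_bounded_diff hd x y
  have h2 := le_add_card_mul_of_bounded_diff hd y x
  rw [abs_le]
  constructor <;> cases abs_cases (f y) <;> linarith

theorem integral_pi_succ {α : Type*} [MeasurableSpace α] (ν : Measure α) [IsProbabilityMeasure ν]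
    {n : ℕ} {F : (Fin (n + 1) → α) → ℝ} (hF : Integrable F (Measure.pi fun _ => ν)) :
    ∫ x, F x ∂(Measure.pi fun _ => ν) =
      ∫ y, ∫ a, F (Fin.cons a y) ∂ν ∂(Measure.pi fun _ : Fin n => ν) := by
  have h := (measurePreserving_piFinSuccAbove (fun _ : Fin (n + 1) => ν) 0).symm
  rw [← h.integral_comp', integral_prod_symm]
  · simp [MeasurableEquiv.piFinSuccAbove_symm_apply, Fin.insertNthEquiv]
  · exact (h.integrable_comp_emb (MeasurableEquiv.measurableEmbedding _)).2 hF

theorem measurable_fin_cons {α : Type*} [MeasurableSpace α] {n : ℕ} :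
    Measurable fun q : α × (Fin n → α) => (Fin.cons q.1 q.2 : Fin (n + 1) → α) := by
  refine measurable_pi_iff.2 fun i => ?_
  refine Fin.cases ?_ (fun j => ?_) i
  · simpa using measurable_fst
  · simp only [Fin.cons_succ]
    fun_prop

/-- **McDiarmid's inequality**, as a bound on the moment generating function: a function of `n`
independent identically distributed variables which changes by at most `c` when one variable is
changed is sub-Gaussian with variance proxy `n * c ^ 2 / 4`. -/
theorem integral_exp_le_of_bounded_diff {α : Type*} [MeasurableSpace α] (ν : Measure α)
    [IsProbabilityMeasure ν] {c : ℝ} (hc : 0 ≤ c) (t : ℝ) :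
    ∀ (n : ℕ) (f : (Fin n → α) → ℝ), Measurable f →
      (∀ x i a, f (Function.update x i a) ≤ f x + c) →
      ∫ x, Real.exp (t * (f x - ∫ y, f y ∂(Measure.pi fun _ => ν))) ∂(Measure.pi fun _ => ν) ≤
        Real.exp (n * c ^ 2 * t ^ 2 / 8) := by
  obtain ⟨a₀⟩ : Nonempty α := nonempty_of_isProbabilityMeasure ν
  intro n
  induction n with
  | zero =>
    intro f _ _
    have : ∀ x : Fin 0 → α, f x = f (fun _ => a₀) := fun x => congrArg f (Subsingleton.elim _ _)
    simp [this]
  | succ n ih =>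
    intro f hf hd
    set x₀ : Fin (n + 1) → α := fun _ => a₀
    set C : ℝ := |f x₀| + (n + 1 : ℕ) * c
    have hb : ∀ x, |f x| ≤ C := fun x => by
      simpa only [Fintype.card_fin] using abs_le_of_bounded_diff hd x₀ x
    have hfc : Measurable fun q : α × (Fin n → α) => f (Fin.cons q.1 q.2) :=
      hf.comp measurable_fin_cons
    have hfa : ∀ y : Fin n → α, Measurable fun a => f (Fin.cons a y) := fun y =>
      hfc.comp (measurable_id.prodMk measurable_const)
    have hia : ∀ y : Fin n → α, Integrable (fun a => f (Fin.cons a y)) ν := fun y =>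
      integrable_of_abs_le (hfa y) fun a => hb _
    set g : (Fin n → α) → ℝ := fun y => ∫ a, f (Fin.cons a y) ∂ν with hg
    have hgm : Measurable g :=
      hfc.stronglyMeasurable.integral_prod_left'.measurable
    have hgd : ∀ y i b, g (Function.update y i b) ≤ g y + c := by
      intro y i b
      have : g y + c = ∫ a, (f (Fin.cons a y) + c) ∂ν := by
        rw [integral_add (hia y) (integrable_const c)]; simp [g]
      rw [this]
      refine integral_mono (hia _) ((hia y).add (integrable_const c)) fun a => ?_
      simp only
      rw [Fin.cons_update]
      exact hd _ _ _
    have hgb : ∀ y, |g y| ≤ C := fun y => by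
      have := norm_integral_le_of_norm_le_const (μ := ν) (f := fun a => f (Fin.cons a y)) (C := C)
        (.of_forall fun a => hb _)
      simpa using this
    have hmean : ∫ x, f x ∂(Measure.pi fun _ => ν) = ∫ y, g y ∂(Measure.pi fun _ => ν) :=
      integral_pi_succ ν (integrable_of_abs_le hf hb)
    rw [hmean]
    set m := ∫ y, g y ∂(Measure.pi fun _ => ν)
    have hexp : ∀ u : ℝ, |u| ≤ C → |Real.exp (t * (u - m))| ≤ Real.exp (|t| * (C + |m|)) := by
      intro u hu
      rw [abs_of_pos (Real.exp_pos _), Real.exp_le_exp]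
      refine (le_abs_self _).trans ?_
      rw [abs_mul]
      gcongr
      exact (abs_sub _ _).trans (by linarith)
    rw [integral_pi_succ ν (integrable_of_abs_le (by fun_prop) fun x => hexp _ (hb x))]
    have inner : ∀ y : Fin n → α, ∫ a, Real.exp (t * (f (Fin.cons a y) - m)) ∂ν ≤
        Real.exp (c ^ 2 * t ^ 2 / 8) * Real.exp (t * (g y - m)) := by
      intro y
      have e : ∀ a, Real.exp (t * (f (Fin.cons a y) - m)) =
          Real.exp (t * (f (Fin.cons a y) - g y)) * Real.exp (t * (g y - m)) := by
        intro a; rw [← Real.exp_add]; ring_nf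
      simp_rw [e]
      rw [integral_mul_const]
      refine mul_le_mul_of_nonneg_right ?_ (Real.exp_pos _).le
      -- Hoeffding's lemma, on the interval from the infimum of the section to the infimum plus `c`
      set I := ⨅ a, f (Fin.cons a y)
      have hbdd : BddBelow (Set.range fun a => f (Fin.cons a y)) :=
        ⟨-C, by rintro _ ⟨a, rfl⟩; exact (abs_le.1 (hb _)).1⟩
      have hmem : ∀ a, f (Fin.cons a y) ∈ Set.Icc I (I + c) := by
        intro a
        have : Nonempty α := ⟨a₀⟩
        refine ⟨ciInf_le hbdd a, ?_⟩
        have : f (Fin.cons a y) - c ≤ I := by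
          refine le_ciInf fun b => ?_
          have := hd (Fin.cons b y) 0 a
          rw [Fin.update_cons_zero] at this
          linarith
        linarith
      have hs := (hasSubgaussianMGF_of_mem_Icc (μ := ν) (hfa y).aemeasurable
        (.of_forall hmem)).mgf_le t
      refine hs.trans (le_of_eq ?_)
      congr 1
      simp [abs_of_nonneg hc]
      ring
    have hint : Integrable (fun y => Real.exp (t * (g y - m))) (Measure.pi fun _ : Fin n => ν) :=
      integrable_of_abs_le (by fun_prop) fun x => hexp _ (hgb x)
    calc _ ≤ ∫ y, Real.exp (c ^ 2 * t ^ 2 / 8) * Real.exp (t * (g y - m))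
            ∂(Measure.pi fun _ : Fin n => ν) := by
          refine integral_mono_of_nonneg (.of_forall fun y => ?_) (hint.const_mul _)
            (.of_forall inner)
          exact integral_nonneg fun a => (Real.exp_pos _).le
      _ ≤ Real.exp (c ^ 2 * t ^ 2 / 8) * Real.exp (n * c ^ 2 * t ^ 2 / 8) := by
          rw [integral_const_mul]
          exact mul_le_mul_of_nonneg_left (ih g hgm hgd) (Real.exp_pos _).le
      _ = _ := by
          rw [← Real.exp_add]; push_cast; ring_nf

/-- **McDiarmid's inequality**, upper tail. -/
theorem measureReal_ge_le_of_bounded_diff {α : Type*} [MeasurableSpace α] (ν : Measure α)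
    [IsProbabilityMeasure ν] {c : ℝ} (hc : 0 < c) {n : ℕ} (hn : 0 < n) {f : (Fin n → α) → ℝ}
    (hf : Measurable f) (hd : ∀ x i a, f (Function.update x i a) ≤ f x + c) {T : ℝ} (hT : 0 ≤ T) :
    (Measure.pi fun _ => ν).real {x | T ≤ f x - ∫ y, f y ∂(Measure.pi fun _ => ν)} ≤
      Real.exp (-(2 * T ^ 2 / (n * c ^ 2))) := by
  obtain ⟨a₀⟩ : Nonempty α := nonempty_of_isProbabilityMeasure ν
  set m := ∫ y, f y ∂(Measure.pi fun _ => ν)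
  have hn' : (0 : ℝ) < n := by exact_mod_cast hn
  set C : ℝ := |f fun _ => a₀| + n * c
  have hb : ∀ x, |f x| ≤ C := by simpa using abs_le_of_bounded_diff hd fun _ => a₀
  set t : ℝ := 4 * T / (n * c ^ 2) with ht
  have ht0 : 0 ≤ t := by positivity
  have hint : Integrable (fun x => Real.exp (t * (f x - m))) (Measure.pi fun _ => ν) := by
    refine integrable_of_abs_le (C := Real.exp (t * (C + |m|))) (by fun_prop) fun x => ?_
    rw [abs_of_pos (Real.exp_pos _), Real.exp_le_exp]
    gcongr
    linarith [le_abs_self (f x), hb x, neg_le_abs m]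
  have h1 := measure_ge_le_exp_mul_mgf (X := fun x => f x - m) T ht0 hint
  refine h1.trans ?_
  have h2 := integral_exp_le_of_bounded_diff ν hc.le t n f hf hd
  calc _ ≤ Real.exp (-t * T) * Real.exp (n * c ^ 2 * t ^ 2 / 8) :=
        mul_le_mul_of_nonneg_left h2 (Real.exp_pos _).le
    _ = _ := by
      rw [← Real.exp_add, ht]
      congr 1
      field_simp
      ring

/-- **McDiarmid's inequality**, lower tail. -/
theorem measureReal_le_le_of_bounded_diff {α : Type*} [MeasurableSpace α] (ν : Measure α)
    [IsProbabilityMeasure ν] {c : ℝ} (hc : 0 < c) {n : ℕ} (hn : 0 < n) {f : (Fin n → α) → ℝ}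
    (hf : Measurable f) (hd : ∀ x i a, f (Function.update x i a) ≤ f x + c) {T : ℝ} (hT : 0 ≤ T) :
    (Measure.pi fun _ => ν).real {x | f x ≤ ∫ y, f y ∂(Measure.pi fun _ => ν) - T} ≤
      Real.exp (-(2 * T ^ 2 / (n * c ^ 2))) := by
  refine le_trans (le_of_eq ?_) (measureReal_ge_le_of_bounded_diff ν hc hn (f := fun x => -f x)
    hf.neg (fun x i a => ?_) hT)
  · congr 1
    ext x
    rw [integral_neg]
    simp only [Set.mem_ofPred_eq]
    constructor <;> intro h <;> linarith
  · have := hd (Function.update x i a) i (x i)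
    simp only [Function.update_idem, Function.update_eq_self] at this
    linarith

/-- Replacing a fixed set of coordinates by those of an independent copy preserves a product
probability measure. -/
theorem measurePreserving_piecewise {ι α : Type*} [Fintype ι] [DecidableEq ι] [MeasurableSpace α]
    (ν : Measure α) [IsProbabilityMeasure ν] (J : Finset ι) :
    MeasurePreserving (fun q : (ι → α) × (ι → α) => J.piecewise q.1 q.2)
      ((Measure.pi fun _ => ν).prod (Measure.pi fun _ => ν)) (Measure.pi fun _ => ν) := by
  have hm : Measurable fun q : (ι → α) × (ι → α) => J.piecewise q.1 q.2 := by
    refine measurable_pi_iff.2 fun i => ?_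
    by_cases h : i ∈ J
    · simp only [Finset.piecewise, h, if_true]
      fun_prop
    · simp only [Finset.piecewise, h, if_false]
      fun_prop
  refine ⟨hm, (Measure.pi_eq fun s hs => ?_).symm⟩
  rw [Measure.map_apply hm (MeasurableSet.univ_pi hs)]
  have : (fun q : (ι → α) × (ι → α) => J.piecewise q.1 q.2) ⁻¹' Set.pi Set.univ s =
      Set.pi Set.univ (J.piecewise s fun _ => Set.univ) ×ˢ
        Set.pi Set.univ (J.piecewise (fun _ => Set.univ) s) := by
    ext q
    simp only [Set.mem_preimage, Set.mem_pi, Set.mem_univ, true_imp_iff, Set.mem_prod]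
    rw [← forall_and]
    refine forall_congr' fun i => ?_
    by_cases h : i ∈ J <;> simp [Finset.piecewise, h]
  rw [this, Measure.prod_prod, Measure.pi_pi, Measure.pi_pi, ← Finset.prod_mul_distrib]
  refine Finset.prod_congr rfl fun i _ => ?_
  by_cases h : i ∈ J <;> simp [Finset.piecewise, h]

/-- Conditioning on the coordinates outside `J`: the coordinates in `J` are resampled. -/
theorem integral_pi_eq_integral_piecewise {ι α : Type*} [Fintype ι] [DecidableEq ι]
    [MeasurableSpace α] (ν : Measure α) [IsProbabilityMeasure ν] (J : Finset ι)
    {F : (ι → α) → ℝ} (hF : Measurable F) {C : ℝ} (hC : ∀ x, |F x| ≤ C) :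
    ∫ x, F x ∂(Measure.pi fun _ => ν) =
      ∫ u, ∫ z, F (J.piecewise z u) ∂(Measure.pi fun _ => ν) ∂(Measure.pi fun _ => ν) := by
  have h := measurePreserving_piecewise ν J
  rw [← h.map_eq, integral_map h.measurable.aemeasurable hF.aestronglyMeasurable, h.map_eq]
  exact integral_prod_symm _
    (integrable_of_abs_le (hF.comp h.measurable) fun q => hC _)

theorem measurePreserving_eval_pair {ι α : Type*} [Fintype ι] [DecidableEq ι] [MeasurableSpace α]
    (ν : Measure α) [IsProbabilityMeasure ν] {i j : ι} (hij : i ≠ j) :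
    MeasurePreserving (fun x : ι → α => (x i, x j)) (Measure.pi fun _ => ν) (ν.prod ν) := by
  have hm : Measurable fun x : ι → α => (x i, x j) := by fun_prop
  refine ⟨hm, (Measure.prod_eq fun s t hs ht => ?_).symm⟩
  rw [Measure.map_apply hm (hs.prod ht)]
  have : (fun x : ι → α => (x i, x j)) ⁻¹' s ×ˢ t =
      Set.pi Set.univ fun l => if l = i then s else if l = j then t else Set.univ := by
    ext x
    simp only [Set.mem_preimage, Set.mem_prod, Set.mem_pi, Set.mem_univ, true_imp_iff]
    constructor
    · rintro ⟨h1, h2⟩ l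
      split_ifs with h h' <;> simp_all
    · intro h
      refine ⟨by simpa using h i, by simpa [hij.symm] using h j⟩
  rw [this, Measure.pi_pi, ← Finset.mul_prod_erase _ _ (Finset.mem_univ i),
    ← Finset.mul_prod_erase _ _ (Finset.mem_erase.2 ⟨hij.symm, Finset.mem_univ j⟩)]
  rw [Finset.prod_eq_one]
  · simp [hij.symm]
  · intro l hl
    simp only [Finset.mem_erase] at hl
    simp [hl.1, hl.2.1]

/-- The sum of independent centred copies of a variable bounded by `M` has mean absolute value at
most `√s * M`, where `s` is the number of summands, because its second moment is at most
`s * M ^ 2`. -/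
theorem integral_abs_sum_sub_le {ι α : Type*} [Fintype ι] [DecidableEq ι] [MeasurableSpace α]
    (ν : Measure α) [IsProbabilityMeasure ν] {a : α → ℝ} (ha : Measurable a) {M : ℝ}
    (hM : ∀ x, |a x| ≤ M) (s : Finset ι) :
    ∫ z, |∑ i ∈ s, (a (z i) - ∫ x, a x ∂ν)| ∂(Measure.pi fun _ : ι => ν) ≤
      √(s.card) * M := by
  obtain ⟨a₀⟩ : Nonempty α := nonempty_of_isProbabilityMeasure ν
  have hM0 : 0 ≤ M := (abs_nonneg _).trans (hM a₀)
  set m := ∫ x, a x ∂ν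
  set b : α → ℝ := fun x => a x - m
  have hbm : Measurable b := by fun_prop
  have hmM : |m| ≤ M := by
    have := norm_integral_le_of_norm_le_const (μ := ν) (f := a) (C := M) (.of_forall hM)
    simpa using this
  have hbb : ∀ x, |b x| ≤ 2 * M := fun x => (abs_sub _ _).trans (by linarith [hM x])
  have hai : Integrable a ν := integrable_of_abs_le ha hM
  have hb0 : ∫ x, b x ∂ν = 0 := by
    simp [b, integral_sub hai (integrable_const m), m]
  have hb2 : ∫ x, b x ^ 2 ∂ν ≤ M ^ 2 := by
    have h1 : ∫ x, b x ^ 2 ∂ν = ∫ x, a x ^ 2 ∂ν - m ^ 2 := by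
      have hsq : Integrable (fun x => a x ^ 2) ν :=
        integrable_of_abs_le (by fun_prop) (C := M ^ 2) fun x => by
          rw [abs_pow]; exact pow_le_pow_left₀ (abs_nonneg _) (hM x) 2
      have : (fun x => b x ^ 2) = fun x => a x ^ 2 - (2 * m * a x - m ^ 2) := by
        ext x; simp only [b]; ring
      have hlin : Integrable (fun x => 2 * m * a x - m ^ 2) ν :=
        (hai.const_mul _).sub (integrable_const _)
      rw [this, integral_sub hsq hlin, integral_sub (hai.const_mul _) (integrable_const _), integral_const_mul]
      simp only [integral_const, probReal_univ, smul_eq_mul, one_mul]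
      ring
    have h2 : ∫ x, a x ^ 2 ∂ν ≤ M ^ 2 := by
      have h3 := norm_integral_le_of_norm_le_const (μ := ν) (f := fun x => a x ^ 2) (C := M ^ 2)
        (.of_forall fun x => by
          rw [norm_pow]; exact pow_le_pow_left₀ (abs_nonneg _) (hM x) 2)
      exact (le_abs_self _).trans (by simpa using h3)
    nlinarith [sq_nonneg m]
  set Z : (ι → α) → ℝ := fun z => ∑ i ∈ s, b (z i)
  have hZm : Measurable Z := by fun_prop
  have hZb : ∀ z, |Z z| ≤ s.card * (2 * M) := fun z => by
    refine (Finset.abs_sum_le_sum_abs _ _).trans ?_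
    exact (Finset.sum_le_card_nsmul _ _ _ fun i _ => hbb _).trans (by simp)
  have hpi : ∀ i j : ι, Integrable (fun z : ι → α => b (z i) * b (z j))
      (Measure.pi fun _ : ι => ν) := fun i j =>
    integrable_of_abs_le (by fun_prop) (C := 2 * M * (2 * M)) fun z => by
      rw [abs_mul]
      exact mul_le_mul (hbb _) (hbb _) (abs_nonneg _) (by positivity)
  have hcross : ∀ i j : ι, ∫ z : ι → α, b (z i) * b (z j) ∂(Measure.pi fun _ : ι => ν) =
      if i = j then ∫ x, b x ^ 2 ∂ν else 0 := by
    intro i j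
    split_ifs with h
    · subst h
      have := measurePreserving_eval (fun _ : ι => ν) i
      rw [← this.map_eq, integral_map this.measurable.aemeasurable
        (hbm.pow_const 2).aestronglyMeasurable, this.map_eq]
      simp only [Function.eval]
      congr with z; ring
    · have := measurePreserving_eval_pair ν h
      have h2 : ∫ q : α × α, b q.1 * b q.2 ∂(ν.prod ν) = 0 := by
        rw [integral_prod_mul b b, hb0, zero_mul]
      rw [← h2, ← this.map_eq, integral_map this.measurable.aemeasurable]
      exact (by fun_prop : Measurable fun q : α × α => b q.1 * b q.2).aestronglyMeasurable
  have hZ2 : ∫ z, Z z ^ 2 ∂(Measure.pi fun _ : ι => ν) ≤ s.card * M ^ 2 := by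
    have : (fun z => Z z ^ 2) = fun z : ι → α => ∑ i ∈ s, ∑ j ∈ s, b (z i) * b (z j) := by
      ext z; simp only [Z]; rw [sq, Finset.sum_mul_sum]
    rw [this, integral_finsetSum _ fun i _ => integrable_finsetSum _ fun j _ => hpi i j]
    simp_rw [integral_finsetSum s fun j _ => hpi _ j, hcross]
    simp only [Finset.sum_ite_eq, Finset.sum_ite_mem, Finset.inter_self, Finset.sum_const,
      nsmul_eq_mul]
    gcongr
  set A := ∫ z, |Z z| ∂(Measure.pi fun _ : ι => ν)
  have hZi : Integrable (fun z => |Z z|) (Measure.pi fun _ : ι => ν) :=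
    (integrable_of_abs_le hZm hZb).abs
  have hZ2i : Integrable (fun z => Z z ^ 2) (Measure.pi fun _ : ι => ν) :=
    integrable_of_abs_le (by fun_prop) (C := (s.card * (2 * M)) ^ 2) fun z => by
      rw [abs_pow]; exact pow_le_pow_left₀ (abs_nonneg _) (hZb z) 2
  have hA : A ^ 2 ≤ s.card * M ^ 2 := by
    have h1 : 0 ≤ ∫ z, (|Z z| - A) ^ 2 ∂(Measure.pi fun _ : ι => ν) :=
      integral_nonneg fun z => sq_nonneg _
    have : (fun z => (|Z z| - A) ^ 2) = fun z => Z z ^ 2 - (2 * A * |Z z| - A ^ 2) := by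
      ext z; rw [sub_sq, sq_abs]; ring
    have hlin : Integrable (fun z => 2 * A * |Z z| - A ^ 2) (Measure.pi fun _ : ι => ν) :=
      (hZi.const_mul _).sub (integrable_const _)
    rw [this, integral_sub hZ2i hlin, integral_sub (hZi.const_mul _) (integrable_const _), integral_const_mul] at h1
    simp only [integral_const, probReal_univ, smul_eq_mul, one_mul] at h1
    nlinarith
  have : A ≤ √(s.card * M ^ 2) := Real.le_sqrt_of_sq_le hA
  rwa [Real.sqrt_mul (by positivity), Real.sqrt_sq hM0] at this

/-! ### A maximal inequality for positive parts of row sums -/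

/-- A maximal inequality: if finitely many bounded variables have means at most `a` and
sub-Gaussian moment generating functions at `t`, then the mean of their maximum is at most
`a + L / t + v * t`, where `L` bounds the logarithm of their number. -/
theorem integral_sup'_le_of_integral_exp_le {β ρ : Type*} [MeasurableSpace β] [Fintype ρ]
    [Nonempty ρ] (μ : Measure β) [IsProbabilityMeasure μ] {H : ρ → β → ℝ}
    (hH : ∀ r, Measurable (H r)) {C : ℝ} (hC : ∀ r x, |H r x| ≤ C) {a v L t : ℝ} (ht : 0 < t)
    (ha : ∀ r, ∫ x, H r x ∂μ ≤ a)
    (hv : ∀ r, ∫ x, Real.exp (t * (H r x - ∫ y, H r y ∂μ)) ∂μ ≤ Real.exp (v * t ^ 2))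
    (hL : (Fintype.card ρ : ℝ) ≤ Real.exp L) :
    ∫ x, Finset.univ.sup' Finset.univ_nonempty (fun r => H r x) ∂μ ≤ a + L / t + v * t := by
  set s : ℝ := L / t + v * t with hs
  have hint : ∀ r, Integrable (fun x => Real.exp (t * (H r x - (a + s)))) μ := fun r =>
    integrable_of_abs_le (C := Real.exp (t * (C - (a + s)))) (by have := hH r; fun_prop)
      fun x => by
        rw [abs_of_pos (Real.exp_pos _), Real.exp_le_exp]
        have := (abs_le.1 (hC r x)).2
        gcongr
  have hb : ∀ r, ∫ x, Real.exp (t * (H r x - (a + s))) ∂μ ≤ Real.exp (-L) := by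
    intro r
    calc ∫ x, Real.exp (t * (H r x - (a + s))) ∂μ
        = Real.exp (t * (∫ y, H r y ∂μ - a - s)) *
          ∫ x, Real.exp (t * (H r x - ∫ y, H r y ∂μ)) ∂μ := by
          rw [← integral_const_mul]
          congr with x
          rw [← Real.exp_add]; ring_nf
      _ ≤ Real.exp (-(t * s)) * Real.exp (v * t ^ 2) := by
          refine mul_le_mul (Real.exp_le_exp.2 ?_) (hv r)
            (integral_nonneg fun x => (Real.exp_pos _).le) (Real.exp_pos _).le
          nlinarith [ha r]
      _ = Real.exp (-L) := by
          rw [← Real.exp_add, hs]; congr 1; field_simp; ring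
  have hpt : ∀ x, Finset.univ.sup' Finset.univ_nonempty (fun r => H r x) ≤
      a + s + (∑ r, Real.exp (t * (H r x - (a + s))) - 1) / t := by
    intro x
    refine Finset.sup'_le _ _ fun r _ => ?_
    have h1 := Real.add_one_le_exp (t * (H r x - (a + s)))
    have h2 := Finset.single_le_sum (f := fun r => Real.exp (t * (H r x - (a + s))))
      (fun r _ => (Real.exp_pos _).le) (Finset.mem_univ r)
    have h3 : H r x - (a + s) ≤ (∑ r, Real.exp (t * (H r x - (a + s))) - 1) / t := by
      rw [le_div_iff₀ ht]
      linarith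
    linarith
  have hsum : Integrable (fun x => ∑ r, Real.exp (t * (H r x - (a + s)))) μ :=
    integrable_finsetSum _ fun r _ => hint r
  have hmax : Integrable (fun x => Finset.univ.sup' Finset.univ_nonempty (fun r => H r x)) μ := by
    refine integrable_of_abs_le (C := C) ?_ fun x => ?_
    · have := Finset.measurable_sup' (f := H) Finset.univ_nonempty fun r _ => hH r
      convert this using 1
      ext x; simp
    · obtain ⟨r, -, hr⟩ := Finset.exists_mem_eq_sup' Finset.univ_nonempty (fun r => H r x)
      rw [hr]; exact hC r x
  calc _ ≤ ∫ x, (a + s + (∑ r, Real.exp (t * (H r x - (a + s))) - 1) / t) ∂μ :=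
        integral_mono hmax ((integrable_const _).add
          ((hsum.sub (integrable_const _)).div_const _)) hpt
    _ = a + s + (∑ r, ∫ x, Real.exp (t * (H r x - (a + s))) ∂μ - 1) / t := by
        have h1 : Integrable (fun x => ∑ r, Real.exp (t * (H r x - (a + s))) - 1) μ :=
          hsum.sub (integrable_const _)
        rw [integral_add (integrable_const _) (h1.div_const _), integral_div,
          integral_sub hsum (integrable_const _), integral_finsetSum _ fun r _ => hint r]
        simp
    _ ≤ a + s + 0 := by
        gcongr
        refine div_nonpos_of_nonpos_of_nonneg ?_ ht.le
        have : ∑ r, ∫ x, Real.exp (t * (H r x - (a + s))) ∂μ ≤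
            Fintype.card ρ * Real.exp (-L) := by
          refine (Finset.sum_le_card_nsmul _ _ _ fun r _ => hb r).trans ?_
          simp
        have h2 : Fintype.card ρ * Real.exp (-L) ≤ 1 := by
          rw [Real.exp_neg, ← div_eq_mul_inv, div_le_one (Real.exp_pos _)]
          exact hL
        linarith
    _ = _ := by rw [hs]; ring

/-- The sum of the positive parts of the row sums, over rows and columns in `J` and without the
diagonal, of the matrix with entries `W (z i) (z j)`. -/
def rowPlus {k : ℕ} {α : Type*} (J : Finset (Fin k)) (W : α → α → ℝ) (z : Fin k → α) : ℝ :=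
  ∑ i ∈ J, max (∑ j ∈ J.erase i, W (z i) (z j)) 0

theorem sum_le_card_mul {ι : Type*} (s : Finset ι) {n : ℕ} (hs : s.card ≤ n) {f : ι → ℝ}
    {M : ℝ} (hM : 0 ≤ M) (hf : ∀ i ∈ s, f i ≤ M) : ∑ i ∈ s, f i ≤ n * M := by
  refine (Finset.sum_le_card_nsmul _ _ _ hf).trans ?_
  rw [nsmul_eq_mul]
  gcongr

theorem card_le_fin {k : ℕ} (s : Finset (Fin k)) : s.card ≤ k := by
  simpa using Finset.card_le_univ s

section rowPlus

variable {k : ℕ} {α : Type*} {J : Finset (Fin k)} {W : α → α → ℝ} {M : ℝ}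

theorem rowPlus_nonneg (z : Fin k → α) : 0 ≤ rowPlus J W z :=
  Finset.sum_nonneg fun _ _ => le_max_right _ _

theorem rowPlus_le (hM0 : 0 ≤ M) (hW : ∀ a b, |W a b| ≤ M) (z : Fin k → α) :
    rowPlus J W z ≤ k * (k * M) := by
  refine sum_le_card_mul _ (card_le_fin _) (by positivity) fun i _ => max_le ?_ (by positivity)
  exact sum_le_card_mul _ (card_le_fin _) hM0 fun j _ => (le_abs_self _).trans (hW _ _)

/-- Changing the `m`-th sample point changes the `m`-th row, whose contribution lies between `0`
and `k * M`, and one entry of each other row, by at most `2 * M` each. -/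
theorem rowPlus_update_le (hM0 : 0 ≤ M) (hW : ∀ a b, |W a b| ≤ M) (z : Fin k → α) (m : Fin k)
    (a : α) : rowPlus J W (Function.update z m a) ≤ rowPlus J W z + 3 * k * M := by
  set z' := Function.update z m a
  have hterm : ∀ i ∈ J, max (∑ j ∈ J.erase i, W (z' i) (z' j)) 0 ≤
      max (∑ j ∈ J.erase i, W (z i) (z j)) 0 + ((if i = m then k * M else 0) + 2 * M) := by
    intro i _
    by_cases him : i = m
    · rw [if_pos him]
      have h1 : ∑ j ∈ J.erase i, W (z' i) (z' j) ≤ k * M :=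
        sum_le_card_mul _ (card_le_fin _) hM0 fun j _ => (le_abs_self _).trans (hW _ _)
      have h2 : (0 : ℝ) ≤ k * M := by positivity
      have h3 := le_max_right (∑ j ∈ J.erase i, W (z i) (z j)) 0
      exact max_le (by linarith) (by linarith)
    · rw [if_neg him]
      have h1 : ∑ j ∈ J.erase i, W (z' i) (z' j) ≤ ∑ j ∈ J.erase i, W (z i) (z j) + 2 * M := by
        rw [← sub_le_iff_le_add', ← Finset.sum_sub_distrib]
        calc _ ≤ ∑ j ∈ J.erase i, if j = m then 2 * M else 0 := by
              refine Finset.sum_le_sum fun j _ => ?_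
              have hi : z' i = z i := Function.update_of_ne him _ _
              split_ifs with hj
              · have := abs_le.1 (hW (z' i) (z' j))
                have := abs_le.1 (hW (z i) (z j))
                linarith
              · have hj : z' j = z j := Function.update_of_ne hj _ _
                rw [hi, hj, sub_self]
          _ ≤ 2 * M := by
              rw [Finset.sum_ite_eq']
              split_ifs <;> linarith
      have h2 := le_max_left (∑ j ∈ J.erase i, W (z i) (z j)) 0
      have h3 := le_max_right (∑ j ∈ J.erase i, W (z i) (z j)) 0
      exact max_le (by linarith) (by linarith)
  refine (Finset.sum_le_sum hterm).trans ?_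
  rw [Finset.sum_add_distrib, Finset.sum_add_distrib]
  have h1 : ∑ i ∈ J, (if i = m then (k * M : ℝ) else 0) ≤ k * M := by
    rw [Finset.sum_ite_eq']
    have : (0 : ℝ) ≤ k * M := by positivity
    split_ifs <;> linarith
  have h2 : ∑ i ∈ J, 2 * M ≤ k * (2 * M) :=
    sum_le_card_mul _ (card_le_fin _) (by linarith) fun _ _ => le_rfl
  change rowPlus J W z + _ ≤ _
  linarith

variable [MeasurableSpace α]

theorem measurable_rowPlus (hW : Measurable (Function.uncurry W)) : Measurable (rowPlus J W) := by
  unfold rowPlus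
  refine Finset.measurable_fun_sum _ fun i _ => Measurable.max ?_ measurable_const
  refine Finset.measurable_fun_sum _ fun j _ => ?_
  have hij : Measurable fun z : Fin k → α => (z i, z j) := by fun_prop
  exact hW.comp hij

/-- Given the `i`-th sample point, the `i`-th row sum is a sum of independent variables, which is
within `√k * M` of its mean. -/
theorem integral_rowPlus_le (ν : Measure α) [IsProbabilityMeasure ν]
    (hWm : Measurable (Function.uncurry W)) (hW : ∀ a b, |W a b| ≤ M) {κ : ℝ}
    (hκ : ∫ a, max (∫ b, W a b ∂ν) 0 ∂ν ≤ κ) :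
    ∫ z, rowPlus J W z ∂(Measure.pi fun _ => ν) ≤ k * (k * κ + √k * M) := by
  obtain ⟨a₀⟩ : Nonempty α := nonempty_of_isProbabilityMeasure ν
  have hM0 : 0 ≤ M := (abs_nonneg _).trans (hW a₀ a₀)
  have hκ0 : 0 ≤ κ := (integral_nonneg fun a => le_max_right _ _).trans hκ
  set w : α → ℝ := fun a => ∫ b, W a b ∂ν with hw
  have hwm : Measurable w := hWm.stronglyMeasurable.integral_prod_right.measurable
  have hwM : ∀ a, |w a| ≤ M := fun a => by
    have := norm_integral_le_of_norm_le_const (μ := ν) (f := W a) (C := M) (.of_forall (hW a))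
    simpa using this
  have hrowm : ∀ i, Measurable fun z : Fin k → α => max (∑ j ∈ J.erase i, W (z i) (z j)) 0 :=
    fun i => by
      refine Measurable.max (Finset.measurable_fun_sum _ fun j _ => ?_) measurable_const
      have hij : Measurable fun z : Fin k → α => (z i, z j) := by fun_prop
      exact hWm.comp hij
  have hrowb : ∀ i (z : Fin k → α), |max (∑ j ∈ J.erase i, W (z i) (z j)) 0| ≤ k * M := by
    intro i z
    rw [abs_of_nonneg (le_max_right _ _)]
    refine max_le ?_ (by positivity)
    exact sum_le_card_mul _ (card_le_fin _) hM0 fun j _ => (le_abs_self _).trans (hW _ _)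
  unfold rowPlus
  rw [integral_finsetSum _ fun i _ => integrable_of_abs_le (hrowm i) (hrowb i)]
  refine sum_le_card_mul _ (card_le_fin _) (by positivity) fun i _ => ?_
  rw [integral_pi_eq_integral_piecewise ν ({i}ᶜ : Finset (Fin k)) (hrowm i) (hrowb i)]
  have hinner : ∀ u : Fin k → α, ∫ z, max (∑ j ∈ J.erase i,
      W (({i}ᶜ : Finset (Fin k)).piecewise z u i) (({i}ᶜ : Finset (Fin k)).piecewise z u j)) 0
        ∂(Measure.pi fun _ => ν) ≤ k * max (w (u i)) 0 + √k * M := by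
    intro u
    have hle : ∀ z : Fin k → α, max (∑ j ∈ J.erase i,
        W (({i}ᶜ : Finset (Fin k)).piecewise z u i) (({i}ᶜ : Finset (Fin k)).piecewise z u j)) 0 ≤
        k * max (w (u i)) 0 + |∑ j ∈ J.erase i, (W (u i) (z j) - w (u i))| := by
      intro z
      have h1 : ∑ j ∈ J.erase i, W (({i}ᶜ : Finset (Fin k)).piecewise z u i)
          (({i}ᶜ : Finset (Fin k)).piecewise z u j) = ∑ j ∈ J.erase i, W (u i) (z j) := by
        refine Finset.sum_congr rfl fun j hj => ?_
        rw [Finset.piecewise_eq_of_notMem _ _ _ (by simp),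
          Finset.piecewise_eq_of_mem _ _ _ (by simpa using (Finset.mem_erase.1 hj).1)]
      rw [h1]
      have h2 : ∑ j ∈ J.erase i, W (u i) (z j) =
          ∑ j ∈ J.erase i, w (u i) + ∑ j ∈ J.erase i, (W (u i) (z j) - w (u i)) := by
        rw [← Finset.sum_add_distrib]; simp
      have h3 : ∑ j ∈ J.erase i, w (u i) ≤ k * max (w (u i)) 0 :=
        sum_le_card_mul _ (card_le_fin _) (le_max_right _ _) fun _ _ => le_max_left _ _
      have h4 := le_abs_self (∑ j ∈ J.erase i, (W (u i) (z j) - w (u i)))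
      refine max_le (by linarith) ?_
      have := le_max_right (w (u i)) 0
      positivity
    have hdev : Integrable (fun z : Fin k → α => |∑ j ∈ J.erase i, (W (u i) (z j) - w (u i))|)
        (Measure.pi fun _ => ν) := by
      have hm : Measurable (W (u i)) := hWm.comp (measurable_const.prodMk measurable_id)
      refine (integrable_of_abs_le (C := k * (M + M)) ?_ fun z => ?_).abs
      · fun_prop
      · refine (Finset.abs_sum_le_sum_abs _ _).trans ?_
        refine sum_le_card_mul _ (card_le_fin _) (by positivity) fun j _ => ?_
        exact (abs_sub _ _).trans (add_le_add (hW _ _) (hwM _))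
    calc _ ≤ ∫ z, (k * max (w (u i)) 0 + |∑ j ∈ J.erase i, (W (u i) (z j) - w (u i))|)
            ∂(Measure.pi fun _ => ν) :=
          integral_mono_of_nonneg (.of_forall fun z => le_max_right _ _)
            ((integrable_const _).add hdev) (.of_forall hle)
      _ = k * max (w (u i)) 0 + ∫ z, |∑ j ∈ J.erase i, (W (u i) (z j) - w (u i))|
            ∂(Measure.pi fun _ => ν) := by
          rw [integral_add (integrable_const _) hdev]; simp
      _ ≤ _ := by
          gcongr
          have hm : Measurable (W (u i)) := hWm.comp (measurable_const.prodMk measurable_id)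
          refine (integral_abs_sum_sub_le ν hm (hW (u i)) (J.erase i)).trans ?_
          have : ((J.erase i).card : ℝ) ≤ k := by exact_mod_cast card_le_fin _
          gcongr
  have hwi : Integrable (fun u : Fin k → α => max (w (u i)) 0) (Measure.pi fun _ => ν) :=
    integrable_of_abs_le (C := M) (by fun_prop) fun u => by
      rw [abs_of_nonneg (le_max_right _ _)]
      exact max_le ((le_abs_self _).trans (hwM _)) hM0
  calc _ ≤ ∫ u : Fin k → α, (k * max (w (u i)) 0 + √k * M) ∂(Measure.pi fun _ => ν) :=
        integral_mono_of_nonneg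
          (.of_forall fun u => integral_nonneg fun z => le_max_right _ _)
          ((hwi.const_mul _).add (integrable_const _)) (.of_forall hinner)
    _ = k * ∫ a, max (w a) 0 ∂ν + √k * M := by
        rw [integral_add (hwi.const_mul _) (integrable_const _), integral_const_mul]
        congr 1
        · congr 1
          have := measurePreserving_eval (fun _ : Fin k => ν) i
          conv_rhs => rw [← this.map_eq]
          exact (integral_map this.measurable.aemeasurable
            (hwm.max measurable_const).aestronglyMeasurable).symm
        · simp
    _ ≤ _ := by gcongr

/-- McDiarmid's inequality and the maximal inequality, applied to a finite family of kernels. -/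
theorem integral_sup'_rowPlus_le (ν : Measure α) [IsProbabilityMeasure ν] {ρ : Type*} [Fintype ρ]
    [Nonempty ρ] {W : ρ → α → α → ℝ} (hWm : ∀ r, Measurable (Function.uncurry (W r)))
    (hW : ∀ r a b, |W r a b| ≤ M) {κ : ℝ} (hκ : ∀ r, ∫ a, max (∫ b, W r a b ∂ν) 0 ∂ν ≤ κ)
    {L t : ℝ} (ht : 0 < t) (hL : (Fintype.card ρ : ℝ) ≤ Real.exp L) :
    ∫ z, Finset.univ.sup' Finset.univ_nonempty (fun r => rowPlus J (W r) z)
        ∂(Measure.pi fun _ => ν) ≤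
      k * (k * κ + √k * M) + L / t + 9 / 8 * k ^ 3 * M ^ 2 * t := by
  obtain ⟨a₀⟩ : Nonempty α := nonempty_of_isProbabilityMeasure ν
  obtain ⟨r₀⟩ := ‹Nonempty ρ›
  have hM0 : 0 ≤ M := (abs_nonneg _).trans (hW r₀ a₀ a₀)
  refine integral_sup'_le_of_integral_exp_le _ (fun r => measurable_rowPlus (hWm r))
    (C := k * (k * M)) (fun r z => ?_) ht (fun r => integral_rowPlus_le ν (hWm r) (hW r) (hκ r))
    (fun r => ?_) hL
  · rw [abs_of_nonneg (rowPlus_nonneg _)]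
    exact rowPlus_le hM0 (hW r) z
  · refine (integral_exp_le_of_bounded_diff ν (c := 3 * k * M) (by positivity) t k _
      (measurable_rowPlus (hWm r)) fun z i a => rowPlus_update_le hM0 (hW r) z i a).trans
        (le_of_eq ?_)
    congr 1
    ring

end rowPlus

/-! ### Sampling bounded kernels: guiding by a random set of rows -/

/-- The cut norm of a square matrix, without normalization. -/
def matrixCut {k : ℕ} (B : Fin k → Fin k → ℝ) : ℝ :=
  Finset.univ.sup' Finset.univ_nonempty
    fun r : Finset (Fin k) × Finset (Fin k) => |∑ i ∈ r.1, ∑ j ∈ r.2, B i j|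

/-- The matrix of values of a kernel at pairs of sample points, with zeros on the diagonal. -/
def sampleMatrix {k : ℕ} {α : Type*} (V : α × α → ℝ) (x : Fin k → α) (i j : Fin k) : ℝ :=
  if i = j then 0 else V (x i, x j)

/-- The sum of the positive parts of the row sums of `B` over those columns `j` in which the
sampled rows `Q t`, `t ∈ R`, have positive sum. -/
def guidedSum {k q : ℕ} (B : Fin k → Fin k → ℝ) (Q : Fin q → Fin k) (R : Finset (Fin q)) : ℝ :=
  ∑ i, max (∑ j, if 0 < ∑ t ∈ R, B (Q t) j then B i j else 0) 0

/-- The uniform measure on `Fin k`. -/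
abbrev unifFin (k : ℕ) [NeZero k] : Measure (Fin k) := (PMF.uniformOfFintype (Fin k)).toMeasure

theorem integral_unifFin {k : ℕ} [NeZero k] (a : Fin k → ℝ) :
    ∫ i, a i ∂(unifFin k) = (∑ i, a i) / k := by
  rw [PMF.integral_eq_sum]
  simp [div_eq_inv_mul, Finset.mul_sum]

section guidedSum

variable {k q : ℕ} {M : ℝ}

theorem guidedSum_nonneg (B : Fin k → Fin k → ℝ) (Q : Fin q → Fin k) (R : Finset (Fin q)) :
    0 ≤ guidedSum B Q R := Finset.sum_nonneg fun _ _ => le_max_right _ _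

theorem guidedSum_le (hM0 : 0 ≤ M) {B : Fin k → Fin k → ℝ} (hB : ∀ i j, |B i j| ≤ M)
    (Q : Fin q → Fin k) (R : Finset (Fin q)) : guidedSum B Q R ≤ k * (k * M) := by
  refine sum_le_card_mul _ (card_le_fin _) (by positivity) fun i _ => max_le ?_ (by positivity)
  refine sum_le_card_mul _ (card_le_fin _) hM0 fun j _ => ?_
  split_ifs
  · exact (le_abs_self _).trans (hB _ _)
  · exact hM0

/-- A sum over a rectangle `S × T` is controlled by guided sums, on average over `q` rows chosen at
random. The best choice of `T` for a given `S` consists of the columns in which the sum `h` over the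
rows in `S` is positive. Estimating `h` from the sampled rows changes the sign of `h` only where the
estimate is off by at least `|h|`, and the mean error of the estimate is at most `k * M / √q`. -/
theorem sum_sum_le_integral_guidedSum [NeZero k] (hq : 0 < q) {B : Fin k → Fin k → ℝ}
    (hB : ∀ i j, |B i j| ≤ M) (S T : Finset (Fin k)) :
    ∑ i ∈ S, ∑ j ∈ T, B i j ≤
      ∫ Q, Finset.univ.sup' Finset.univ_nonempty (fun R : Finset (Fin q) => guidedSum B Q R)
        ∂(Measure.pi fun _ => unifFin k) + k ^ 2 * M / √q := by
  set ν := unifFin k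
  have hM0 : 0 ≤ M := (abs_nonneg _).trans (hB 0 0)
  have hk : (0 : ℝ) < k := by exact_mod_cast Nat.pos_of_ne_zero (NeZero.ne k)
  have hq' : (0 : ℝ) < q := by exact_mod_cast hq
  set a : Fin k → Fin k → ℝ := fun j i => if i ∈ S then B i j else 0 with ha
  set h : Fin k → ℝ := fun j => ∑ i ∈ S, B i j with hh
  have hah : ∀ j, ∫ i, a j i ∂ν = h j / k := fun j => by
    rw [integral_unifFin]; simp [a, h]
  have haM : ∀ j i, |a j i| ≤ M := fun j i => by
    simp only [a]; split_ifs
    · exact hB _ _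
    · simpa using hM0
  set D : Fin k → (Fin q → Fin k) → ℝ := fun j Q => |∑ t, (a j (Q t) - h j / k)| with hD
  have hint : ∀ f : (Fin q → Fin k) → ℝ, Integrable f (Measure.pi fun _ => ν) := fun f =>
    Integrable.of_finite
  have hDint : ∀ j, ∫ Q, D j Q ∂(Measure.pi fun _ => ν) ≤ √q * M := by
    intro j
    have := integral_abs_sum_sub_le ν (a := a j) (measurable_of_finite _) (haM j)
      (Finset.univ : Finset (Fin q))
    rwa [hah, Finset.card_univ, Fintype.card_fin] at this
  have hpt : ∀ Q : Fin q → Fin k, ∑ i ∈ S, ∑ j ∈ T, B i j ≤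
      Finset.univ.sup' Finset.univ_nonempty (fun R : Finset (Fin q) => guidedSum B Q R) +
        k / q * ∑ j, D j Q := by
    intro Q
    set R : Finset (Fin q) := Finset.univ.filter fun t => Q t ∈ S with hR
    have hest : ∀ j, ∑ t ∈ R, B (Q t) j = ∑ t, a j (Q t) := fun j => by
      rw [hR, Finset.sum_filter]
    have hDj : ∀ j, D j Q = |∑ t, a j (Q t) - q * (h j / k)| := fun j => by
      simp only [hD]; rw [Finset.sum_sub_distrib]; simp
    have hcol : ∀ j, max (h j) 0 ≤
        (if 0 < ∑ t ∈ R, B (Q t) j then h j else 0) + k / q * D j Q := by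
      intro j
      rw [hest, hDj]
      set e := ∑ t, a j (Q t)
      have e1 : k / q * |e - q * (h j / k)| = |k / q * e - h j| := by
        rw [← abs_of_pos (div_pos hk hq'), ← abs_mul, abs_of_pos (div_pos hk hq')]
        congr 1
        field_simp
      rw [e1]
      split_ifs with he
      · have h1 : 0 < k / q * e := by positivity
        refine max_le (by linarith [abs_nonneg (k / q * e - h j)]) ?_
        linarith [le_abs_self (k / q * e - h j)]
      · have h1 : k / q * e ≤ 0 := mul_nonpos_of_nonneg_of_nonpos (by positivity) (not_lt.1 he)
        refine max_le (by linarith [neg_le_abs (k / q * e - h j)]) ?_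
        linarith [abs_nonneg (k / q * e - h j)]
    calc ∑ i ∈ S, ∑ j ∈ T, B i j = ∑ j ∈ T, h j := Finset.sum_comm
      _ ≤ ∑ j ∈ T, max (h j) 0 := Finset.sum_le_sum fun j _ => le_max_left _ _
      _ ≤ ∑ j, max (h j) 0 := Finset.sum_le_sum_of_subset_of_nonneg (Finset.subset_univ _)
          fun j _ _ => le_max_right _ _
      _ ≤ ∑ j, ((if 0 < ∑ t ∈ R, B (Q t) j then h j else 0) + k / q * D j Q) :=
          Finset.sum_le_sum fun j _ => hcol j
      _ = ∑ i ∈ S, ∑ j, (if 0 < ∑ t ∈ R, B (Q t) j then B i j else 0) +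
            k / q * ∑ j, D j Q := by
          rw [Finset.sum_add_distrib, Finset.mul_sum, Finset.sum_comm (s := S)]
          congr 1
          refine Finset.sum_congr rfl fun j _ => ?_
          split_ifs <;> simp [h]
      _ ≤ guidedSum B Q R + k / q * ∑ j, D j Q := by
          gcongr
          refine (Finset.sum_le_sum fun i _ => le_max_left _ 0).trans ?_
          exact Finset.sum_le_sum_of_subset_of_nonneg (Finset.subset_univ _)
            fun j _ _ => le_max_right _ _
      _ ≤ _ := by
          gcongr
          exact Finset.le_sup' (fun R => guidedSum B Q R) (Finset.mem_univ R)
  calc ∑ i ∈ S, ∑ j ∈ T, B i j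
      = ∫ _Q : Fin q → Fin k, ∑ i ∈ S, ∑ j ∈ T, B i j ∂(Measure.pi fun _ => ν) := by simp
    _ ≤ _ := integral_mono (hint _) (hint _) hpt
    _ = ∫ Q, Finset.univ.sup' Finset.univ_nonempty (fun R : Finset (Fin q) => guidedSum B Q R)
          ∂(Measure.pi fun _ => ν) + k / q * ∑ j, ∫ Q, D j Q ∂(Measure.pi fun _ => ν) := by
        rw [integral_add (hint _) (hint _), integral_const_mul,
          integral_finsetSum _ fun j _ => hint _]
    _ ≤ _ := by
        gcongr
        calc k / q * ∑ j, ∫ Q, D j Q ∂(Measure.pi fun _ => ν) ≤ k / q * (k * (√q * M)) := by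
              gcongr
              exact sum_le_card_mul _ (card_le_fin _) (by positivity) fun j _ => hDint j
          _ = _ := by
              have : (q : ℝ) = √q * √q := (Real.mul_self_sqrt hq'.le).symm
              have h0 : √(q : ℝ) ≠ 0 := (Real.sqrt_pos.2 hq').ne'
              rw [div_mul_eq_mul_div, div_eq_div_iff hq'.ne' h0]
              nth_rw 3 [this]
              ring

/-- Discarding from a nonnegative sum of positive parts of row sums the rows and columns outside
`J` costs at most `M` per discarded entry. -/
theorem sum_max_le_sum_max_add (hM0 : 0 ≤ M) {c : Fin k → Fin k → ℝ} (hc : ∀ i j, |c i j| ≤ M)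
    (J : Finset (Fin k)) {q : ℕ} (hJ : Jᶜ.card ≤ q) :
    ∑ i, max (∑ j, c i j) 0 ≤ ∑ i ∈ J, max (∑ j ∈ J, c i j) 0 + 2 * q * k * M := by
  rw [← Finset.sum_add_sum_compl J]
  have h1 : ∑ i ∈ Jᶜ, max (∑ j, c i j) 0 ≤ q * (k * M) :=
    sum_le_card_mul _ hJ (by positivity) fun i _ => max_le
      (sum_le_card_mul _ (card_le_fin _) hM0 fun j _ => (le_abs_self _).trans (hc _ _))
      (by positivity)
  have h2 : ∑ i ∈ J, max (∑ j, c i j) 0 ≤ ∑ i ∈ J, (max (∑ j ∈ J, c i j) 0 + q * M) := by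
    refine Finset.sum_le_sum fun i _ => ?_
    have h3 : ∑ j ∈ Jᶜ, c i j ≤ q * M :=
      sum_le_card_mul _ hJ hM0 fun j _ => (le_abs_self _).trans (hc _ _)
    have h4 := le_max_left (∑ j ∈ J, c i j) 0
    have h5 := le_max_right (∑ j ∈ J, c i j) 0
    rw [← Finset.sum_add_sum_compl J]
    have h6 : (0 : ℝ) ≤ q * M := by positivity
    exact max_le (by linarith) (by linarith)
  rw [Finset.sum_add_distrib] at h2
  have h7 : ∑ i ∈ J, (q * M : ℝ) ≤ k * (q * M) :=
    sum_le_card_mul _ (card_le_fin _) (by positivity) fun _ _ => le_rfl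
  linarith

/-- The sign `1` for `true` and `-1` for `false`, through which absolute values of sums are treated
as sums for the kernel and for its negative. -/
def sgn (b : Bool) : ℝ := if b then 1 else -1

theorem abs_sgn_mul (b : Bool) (x : ℝ) : |sgn b * x| = |x| := by
  cases b <;> simp [sgn]

theorem abs_sampleMatrix_le {α : Type*} {V : α × α → ℝ} (hM0 : 0 ≤ M) (hV : ∀ p, |V p| ≤ M) (x : Fin k → α)
    (i j : Fin k) : |sampleMatrix V x i j| ≤ M := by
  unfold sampleMatrix; split_ifs
  · simpa using hM0
  · exact hV _

variable {α : Type*} [MeasurableSpace α]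

theorem measurable_sampleMatrix {V : α × α → ℝ} (hV : Measurable V) (i j : Fin k) :
    Measurable fun x : Fin k → α => sampleMatrix V x i j := by
  unfold sampleMatrix
  split_ifs
  · exact measurable_const
  · have hij : Measurable fun z : Fin k → α => (z i, z j) := by fun_prop
    exact hV.comp hij

theorem measurable_guidedSum {V : α × α → ℝ} (hV : Measurable V) (s : ℝ) (Q : Fin q → Fin k)
    (R : Finset (Fin q)) :
    Measurable fun x : Fin k → α => guidedSum (fun i j => s * sampleMatrix V x i j) Q R := by
  have hB := fun i j => (measurable_sampleMatrix (α := α) (k := k) hV i j).const_mul s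
  unfold guidedSum
  refine Finset.measurable_fun_sum _ fun i _ => Measurable.max ?_ measurable_const
  refine Finset.measurable_fun_sum _ fun j _ => Measurable.ite ?_ (hB i j) measurable_const
  exact measurableSet_lt measurable_const (Finset.measurable_fun_sum _ fun t _ => hB _ _)

theorem measurable_sup'_guidedSum {V : α × α → ℝ} (hV : Measurable V) (Q : Fin q → Fin k) :
    Measurable fun x : Fin k → α => Finset.univ.sup' Finset.univ_nonempty
      (fun r : Bool × Finset (Fin q) =>
        guidedSum (fun i j => sgn r.1 * sampleMatrix V x i j) Q r.2) := by
  have := Finset.measurable_sup' (s := Finset.univ)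
    (f := fun (r : Bool × Finset (Fin q)) (x : Fin k → α) =>
      guidedSum (fun i j => sgn r.1 * sampleMatrix V x i j) Q r.2) Finset.univ_nonempty
    fun r _ => measurable_guidedSum hV (sgn r.1) Q r.2
  convert this using 1
  ext x; simp

/-- For fixed sampled rows `Q`, condition on the sample points with index in the range of `Q`. The
columns entering a guided sum are then determined by fixed measurable sets, so that the guided sums
are a finite family to which the maximal inequality applies. -/
theorem integral_sup'_guidedSum_le (ν : Measure α) [IsProbabilityMeasure ν] {V : α × α → ℝ}
    (hVm : Measurable V) (hV : ∀ p, |V p| ≤ M) {κ : ℝ}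
    (hκ : ∀ A D : Set α, MeasurableSet A → MeasurableSet D →
      |∫ z in A ×ˢ D, V z ∂(ν.prod ν)| ≤ κ) (Q : Fin q → Fin k) {t : ℝ} (ht : 0 < t) :
    ∫ x, Finset.univ.sup' Finset.univ_nonempty (fun r : Bool × Finset (Fin q) =>
        guidedSum (fun i j => sgn r.1 * sampleMatrix V x i j) Q r.2)
          ∂(Measure.pi fun _ : Fin k => ν) ≤
      k * (k * κ + √k * M) + (q + 1) / t + 9 / 8 * k ^ 3 * M ^ 2 * t + 2 * q * k * M := by
  obtain ⟨a₀⟩ : Nonempty α := nonempty_of_isProbabilityMeasure ν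
  have hM0 : 0 ≤ M := (abs_nonneg _).trans (hV (a₀, a₀))
  set J : Finset (Fin k) := (Finset.univ.image Q)ᶜ with hJ
  have hJc : Jᶜ.card ≤ q := by
    rw [hJ, compl_compl]
    simpa using Finset.card_image_le (s := (Finset.univ : Finset (Fin q))) (f := Q)
  have hQJ : ∀ s, Q s ∉ J := fun s => by simp [hJ]
  set F : (Fin k → α) → ℝ := fun x => Finset.univ.sup' Finset.univ_nonempty
    (fun r : Bool × Finset (Fin q) =>
      guidedSum (fun i j => sgn r.1 * sampleMatrix V x i j) Q r.2) with hF
  have hBb : ∀ (b : Bool) (x : Fin k → α) i j, |sgn b * sampleMatrix V x i j| ≤ M :=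
    fun b x i j => by rw [abs_sgn_mul]; exact abs_sampleMatrix_le hM0 hV x i j
  have hF0 : ∀ x, 0 ≤ F x := fun x =>
    (guidedSum_nonneg _ _ _).trans (Finset.le_sup' (fun r : Bool × Finset (Fin q) =>
      guidedSum (fun i j => sgn r.1 * sampleMatrix V x i j) Q r.2)
      (Finset.mem_univ (true, ∅)))
  have hFb : ∀ x, |F x| ≤ k * (k * M) := fun x => by
    rw [abs_of_nonneg (hF0 x)]
    exact Finset.sup'_le _ _ fun r _ => guidedSum_le hM0 (hBb r.1 x) _ _
  rw [integral_pi_eq_integral_piecewise ν J (measurable_sup'_guidedSum hVm Q) hFb]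
  set W : (Fin k → α) → Bool × Finset (Fin q) → α → α → ℝ := fun u r a b =>
    if 0 < ∑ s ∈ r.2, sgn r.1 * V (u (Q s), b) then sgn r.1 * V (a, b) else 0 with hW
  have hWb : ∀ u r a b, |W u r a b| ≤ M := fun u r a b => by
    simp only [hW]; split_ifs
    · rw [abs_sgn_mul]; exact hV _
    · simpa using hM0
  have hset : ∀ (u : Fin k → α) (r : Bool × Finset (Fin q)), MeasurableSet {b : α | 0 < ∑ s ∈ r.2, sgn r.1 * V (u (Q s), b)} := by
    intro u r
    refine measurableSet_lt measurable_const (Finset.measurable_fun_sum _ fun s _ => ?_)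
    exact (hVm.comp (measurable_const.prodMk measurable_id)).const_mul _
  have hWm : ∀ u r, Measurable (Function.uncurry (W u r)) := fun u r =>
    Measurable.ite (measurable_snd (hset u r)) (hVm.const_mul _) measurable_const
  have hWκ : ∀ u r, ∫ a, max (∫ b, W u r a b ∂ν) 0 ∂ν ≤ κ := by
    intro u r
    have hwm : Measurable fun a => ∫ b, W u r a b ∂ν :=
      (hWm u r).stronglyMeasurable.integral_prod_right.measurable
    set A : Set α := {a | 0 < ∫ b, W u r a b ∂ν}
    set D : Set α := {b : α | 0 < ∑ s ∈ r.2, sgn r.1 * V (u (Q s), b)}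
    have hA : MeasurableSet A := measurableSet_lt measurable_const hwm
    have hVi : Integrable V (ν.prod ν) := integrable_of_abs_le hVm hV
    have e : ∫ a, max (∫ b, W u r a b ∂ν) 0 ∂ν = sgn r.1 * ∫ z in A ×ˢ D, V z ∂(ν.prod ν) := by
      rw [setIntegral_prod _ hVi.integrableOn, ← integral_const_mul, ← integral_indicator hA]
      congr with a
      have e2 : ∫ b, W u r a b ∂ν = sgn r.1 * ∫ b in D, V (a, b) ∂ν := by
        rw [← integral_const_mul, ← integral_indicator (hset u r)]
        rfl
      by_cases h : a ∈ A
      · rw [Set.indicator_of_mem h, ← e2]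
        exact max_eq_left (le_of_lt h)
      · rw [Set.indicator_of_notMem h]
        exact max_eq_right (not_lt.1 h)
    rw [e]
    refine (le_abs_self _).trans ?_
    rw [abs_sgn_mul]
    exact hκ A D hA (hset u r)
  have hinner : ∀ u : Fin k → α, ∫ z, F (J.piecewise z u) ∂(Measure.pi fun _ : Fin k => ν) ≤
      k * (k * κ + √k * M) + (q + 1) / t + 9 / 8 * k ^ 3 * M ^ 2 * t + 2 * q * k * M := by
    intro u
    have hle : ∀ z : Fin k → α, F (J.piecewise z u) ≤
        Finset.univ.sup' Finset.univ_nonempty (fun r => rowPlus J (W u r) z) +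
          2 * q * k * M := by
      intro z
      refine Finset.sup'_le _ _ fun r _ => ?_
      set x := J.piecewise z u with hx
      refine (sum_max_le_sum_max_add hM0 (fun i j => ?_) J hJc).trans ?_
      · split_ifs
        · exact hBb _ _ _ _
        · simpa using hM0
      · gcongr
        refine le_trans (le_of_eq ?_) (Finset.le_sup' (fun r => rowPlus J (W u r) z)
          (Finset.mem_univ r))
        refine Finset.sum_congr rfl fun i hi => ?_
        congr 1
        rw [← Finset.add_sum_erase J _ hi]
        have hdiag : (if 0 < ∑ s ∈ r.2, sgn r.1 * sampleMatrix V x (Q s) i then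
            sgn r.1 * sampleMatrix V x i i else 0) = 0 := by
          simp [sampleMatrix]
        rw [hdiag, zero_add]
        refine Finset.sum_congr rfl fun j hj => ?_
        obtain ⟨hji, hjJ⟩ := Finset.mem_erase.1 hj
        have hxz : ∀ l ∈ J, x l = z l := fun l hl => Finset.piecewise_eq_of_mem _ _ _ hl
        have hxu : ∀ s, x (Q s) = u (Q s) := fun s =>
          Finset.piecewise_eq_of_notMem _ _ _ (hQJ s)
        have h1 : ∀ s, sampleMatrix V x (Q s) j = V (u (Q s), z j) := fun s => by
          have : Q s ≠ j := fun h => hQJ s (h ▸ hjJ)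
          simp [sampleMatrix, this, hxu, hxz j hjJ]
        have h2 : sampleMatrix V x i j = V (z i, z j) := by
          simp [sampleMatrix, hji.symm, hxz i hi, hxz j hjJ]
        simp only [h1, h2, hW]
    have hsupi : Integrable (fun z => Finset.univ.sup' Finset.univ_nonempty
        (fun r => rowPlus J (W u r) z)) (Measure.pi fun _ : Fin k => ν) := by
      refine integrable_of_abs_le (C := k * (k * M)) ?_ fun z => ?_
      · have := Finset.measurable_sup' (s := Finset.univ)
          (f := fun (r : Bool × Finset (Fin q)) (z : Fin k → α) => rowPlus J (W u r) z)
          Finset.univ_nonempty fun r _ => measurable_rowPlus (hWm u r)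
        convert this using 1
        ext x; simp
      · obtain ⟨r, -, hr⟩ := Finset.exists_mem_eq_sup' Finset.univ_nonempty
          (fun r => rowPlus J (W u r) z)
        rw [hr, abs_of_nonneg (rowPlus_nonneg _)]
        exact rowPlus_le hM0 (hWb u r) z
    have hcard : (Fintype.card (Bool × Finset (Fin q)) : ℝ) ≤ Real.exp (q + 1) := by
      have h2 : (2 : ℝ) ≤ Real.exp 1 := by linarith [Real.add_one_le_exp (1 : ℝ)]
      have : (Fintype.card (Bool × Finset (Fin q)) : ℝ) = 2 ^ (q + 1) := by
        simp [pow_succ, mul_comm]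
      rw [this]
      calc (2 : ℝ) ^ (q + 1) ≤ Real.exp 1 ^ (q + 1) := by gcongr
        _ = _ := by rw [← Real.exp_nat_mul]; push_cast; ring_nf
    calc _ ≤ ∫ z, (Finset.univ.sup' Finset.univ_nonempty (fun r => rowPlus J (W u r) z) +
            2 * q * k * M) ∂(Measure.pi fun _ : Fin k => ν) :=
          integral_mono_of_nonneg (.of_forall fun z => hF0 _)
            (hsupi.add (integrable_const _)) (.of_forall hle)
      _ = ∫ z, Finset.univ.sup' Finset.univ_nonempty (fun r => rowPlus J (W u r) z)
            ∂(Measure.pi fun _ : Fin k => ν) + 2 * q * k * M := by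
          rw [integral_add hsupi (integrable_const _)]; simp
      _ ≤ _ := by
          gcongr
          exact integral_sup'_rowPlus_le ν (hWm u) (hWb u) (hWκ u) ht hcard
  calc _ ≤ ∫ _u : Fin k → α, (k * (k * κ + √k * M) + (q + 1) / t +
          9 / 8 * k ^ 3 * M ^ 2 * t + 2 * q * k * M) ∂(Measure.pi fun _ : Fin k => ν) :=
        integral_mono_of_nonneg (.of_forall fun u => integral_nonneg fun z => hF0 _)
          (integrable_const _) (.of_forall hinner)
    _ = _ := by simp

theorem matrixCut_nonneg (B : Fin k → Fin k → ℝ) : 0 ≤ matrixCut B :=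
  (abs_nonneg _).trans (Finset.le_sup' (fun r : Finset (Fin k) × Finset (Fin k) =>
    |∑ i ∈ r.1, ∑ j ∈ r.2, B i j|) (Finset.mem_univ (∅, ∅)))

theorem le_matrixCut (B : Fin k → Fin k → ℝ) (S T : Finset (Fin k)) :
    |∑ i ∈ S, ∑ j ∈ T, B i j| ≤ matrixCut B :=
  Finset.le_sup' (fun r : Finset (Fin k) × Finset (Fin k) => |∑ i ∈ r.1, ∑ j ∈ r.2, B i j|)
    (Finset.mem_univ (S, T))

/-- Both signs of a sum over a rectangle are covered by the guided sums of `B` and of `-B`. -/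
theorem matrixCut_le_integral_guidedSum [NeZero k] (hq : 0 < q) {B : Fin k → Fin k → ℝ}
    (hB : ∀ i j, |B i j| ≤ M) :
    matrixCut B ≤ ∫ Q, Finset.univ.sup' Finset.univ_nonempty (fun r : Bool × Finset (Fin q) =>
        guidedSum (fun i j => sgn r.1 * B i j) Q r.2)
        ∂(Measure.pi fun _ => unifFin k) + k ^ 2 * M / √q := by
  refine Finset.sup'_le _ _ fun r _ => ?_
  obtain ⟨b, hb⟩ : ∃ b, |∑ i ∈ r.1, ∑ j ∈ r.2, B i j| = ∑ i ∈ r.1, ∑ j ∈ r.2, sgn b * B i j := by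
    rcases abs_choice (∑ i ∈ r.1, ∑ j ∈ r.2, B i j) with h | h
    · exact ⟨true, by rw [h]; simp [sgn]⟩
    · exact ⟨false, by rw [h]; simp [sgn]⟩
  rw [hb]
  refine (sum_sum_le_integral_guidedSum hq (B := fun i j => sgn b * B i j) (M := M)
    (fun i j => by rw [abs_sgn_mul]; exact hB i j) r.1 r.2).trans ?_
  refine add_le_add (integral_mono Integrable.of_finite Integrable.of_finite fun Q => ?_) le_rfl
  exact Finset.sup'_le _ _ fun R _ => Finset.le_sup' (fun r : Bool × Finset (Fin q) =>
        guidedSum (fun i j => sgn r.1 * B i j) Q r.2) (Finset.mem_univ (b, R))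

/-- The expected cut norm of a sampled matrix, for a bounded kernel, with the size `q` of the
guiding sample and the parameter `t` of the maximal inequality still free. -/
theorem integral_matrixCut_le_aux [NeZero k] (ν : Measure α) [IsProbabilityMeasure ν]
    {V : α × α → ℝ} (hVm : Measurable V) (hV : ∀ p, |V p| ≤ M) {κ : ℝ}
    (hκ : ∀ A D : Set α, MeasurableSet A → MeasurableSet D →
      |∫ z in A ×ˢ D, V z ∂(ν.prod ν)| ≤ κ) (hq : 0 < q) {t : ℝ} (ht : 0 < t) :
    ∫ x, matrixCut (sampleMatrix V x) ∂(Measure.pi fun _ : Fin k => ν) ≤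
      k * (k * κ + √k * M) + (q + 1) / t + 9 / 8 * k ^ 3 * M ^ 2 * t + 2 * q * k * M +
        k ^ 2 * M / √q := by
  obtain ⟨a₀⟩ : Nonempty α := nonempty_of_isProbabilityMeasure ν
  have hM0 : 0 ≤ M := (abs_nonneg _).trans (hV (a₀, a₀))
  set μ := Measure.pi fun _ : Fin k => ν
  set μQ := Measure.pi fun _ : Fin q => unifFin k
  set F : (Fin k → α) → (Fin q → Fin k) → ℝ := fun x Q =>
    Finset.univ.sup' Finset.univ_nonempty (fun r : Bool × Finset (Fin q) =>
        guidedSum (fun i j => sgn r.1 * sampleMatrix V x i j) Q r.2) with hF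
  have hBb : ∀ (b : Bool) (x : Fin k → α) i j, |sgn b * sampleMatrix V x i j| ≤ M :=
    fun b x i j => by rw [abs_sgn_mul]; exact abs_sampleMatrix_le hM0 hV x i j
  have hFb : ∀ x Q, |F x Q| ≤ k * (k * M) := fun x Q => by
    obtain ⟨r, -, hr⟩ := Finset.exists_mem_eq_sup' Finset.univ_nonempty
      (fun r : Bool × Finset (Fin q) =>
        guidedSum (fun i j => sgn r.1 * sampleMatrix V x i j) Q r.2)
    simp only [hF]
    rw [hr, abs_of_nonneg (guidedSum_nonneg _ _ _)]
    exact guidedSum_le hM0 (hBb r.1 x) _ _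
  have hFm : Measurable (Function.uncurry F) :=
    measurable_from_prod_countable_left fun Q => measurable_sup'_guidedSum hVm Q
  have hFi : Integrable (Function.uncurry F) (μ.prod μQ) :=
    integrable_of_abs_le hFm fun p => hFb p.1 p.2
  calc _ ≤ ∫ x, (∫ Q, F x Q ∂μQ + k ^ 2 * M / √q) ∂μ := by
        refine integral_mono_of_nonneg (.of_forall fun x => matrixCut_nonneg _)
          (hFi.integral_prod_left.add (integrable_const _)) (.of_forall fun x => ?_)
        exact matrixCut_le_integral_guidedSum hq fun i j => abs_sampleMatrix_le hM0 hV x i j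
    _ = ∫ Q, ∫ x, F x Q ∂μ ∂μQ + k ^ 2 * M / √q := by
        have h1 : Integrable (fun x => ∫ Q, F x Q ∂μQ) μ := hFi.integral_prod_left
        rw [integral_add h1 (integrable_const _), integral_integral_swap hFi]
        simp
    _ ≤ ∫ _Q : Fin q → Fin k, (k * (k * κ + √k * M) + (q + 1) / t +
          9 / 8 * k ^ 3 * M ^ 2 * t + 2 * q * k * M) ∂μQ + k ^ 2 * M / √q := by
        refine add_le_add (integral_mono Integrable.of_finite Integrable.of_finite
          fun Q => ?_) le_rfl
        exact integral_sup'_guidedSum_le ν hVm hV hκ Q ht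
    _ = _ := by simp

end guidedSum

/-- The expected normalized cut norm of a `k`-sample of a bounded kernel exceeds the cut norm of the
kernel, represented by its upper bound `κ`, by at most `11 * M * k ^ (-1 / 4)`. -/
theorem integral_matrixCut_le_of_bounded {α : Type*} [MeasurableSpace α] {k : ℕ} (hk : 0 < k)
    {M : ℝ} (hM : 0 < M) (ν : Measure α) [IsProbabilityMeasure ν]
    {V : α × α → ℝ} (hVm : Measurable V) (hV : ∀ p, |V p| ≤ M) {κ : ℝ}
    (hκ : ∀ A D : Set α, MeasurableSet A → MeasurableSet D →
      |∫ z in A ×ˢ D, V z ∂(ν.prod ν)| ≤ κ) :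
    ∫ x, matrixCut (sampleMatrix V x) ∂(Measure.pi fun _ : Fin k => ν) ≤
      k ^ 2 * (κ + 11 * M * (k : ℝ) ^ (-(1 / 4) : ℝ)) := by
  have : NeZero k := ⟨hk.ne'⟩
  have hk1 : (1 : ℝ) ≤ k := by exact_mod_cast hk
  have hk0 : (0 : ℝ) < k := by linarith
  -- everything is expressed through `s = k ^ (1 / 4)`; the guiding sample has about `√k` rows
  set s : ℝ := (k : ℝ) ^ (1 / 4 : ℝ) with hs
  have hs1 : 1 ≤ s := Real.one_le_rpow hk1 (by norm_num)
  have hs0 : 0 < s := by linarith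
  have hs4 : (k : ℝ) = s ^ 4 := by
    rw [hs, ← Real.rpow_natCast, ← Real.rpow_mul hk0.le]; norm_num
  have hsinv : (k : ℝ) ^ (-(1 / 4) : ℝ) = s⁻¹ := by rw [Real.rpow_neg hk0.le]
  set q : ℕ := ⌈s ^ 2⌉₊ with hq
  have hq1 : s ^ 2 ≤ q := Nat.le_ceil _
  have hq2 : (q : ℝ) < s ^ 2 + 1 := Nat.ceil_lt_add_one (by positivity)
  have hq0 : 0 < q := Nat.ceil_pos.2 (by positivity)
  have hs2 : 1 ≤ s ^ 2 := one_le_pow₀ hs1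
  have h := integral_matrixCut_le_aux (k := k) ν hVm hV hκ hq0 (t := (s ^ 5 * M)⁻¹)
    (by positivity)
  refine h.trans ?_
  have hsqrtk : √(k : ℝ) = s ^ 2 := by
    rw [hs4, show s ^ 4 = (s ^ 2) ^ 2 by ring, Real.sqrt_sq (by positivity)]
  have hsqrtq : s ≤ √(q : ℝ) := Real.le_sqrt_of_sq_le hq1
  rw [hsqrtk, hsinv, hs4, div_inv_eq_mul]
  have h67 : s ^ 6 ≤ s ^ 7 := pow_le_pow_right₀ hs1 (by norm_num)
  have t1 : (q + 1 : ℝ) * (s ^ 5 * M) ≤ 3 * s ^ 7 * M := by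
    have : (q + 1 : ℝ) ≤ 3 * s ^ 2 := by linarith
    calc _ ≤ 3 * s ^ 2 * (s ^ 5 * M) := by gcongr
      _ = _ := by ring
  have t2 : 9 / 8 * (s ^ 4) ^ 3 * M ^ 2 * (s ^ 5 * M)⁻¹ = 9 / 8 * s ^ 7 * M := by
    field_simp
  have t3 : 2 * q * s ^ 4 * M ≤ 4 * s ^ 7 * M := by
    calc 2 * q * s ^ 4 * M ≤ 2 * (2 * s ^ 2) * s ^ 4 * M := by gcongr; linarith
      _ = 4 * s ^ 6 * M := by ring
      _ ≤ _ := by gcongr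
  have t4 : (s ^ 4) ^ 2 * M / √q ≤ s ^ 7 * M := by
    rw [div_le_iff₀ (by linarith)]
    calc (s ^ 4) ^ 2 * M = s ^ 7 * M * s := by ring
      _ ≤ _ := by gcongr
  have t5 : s ^ 4 * (s ^ 4 * κ + s ^ 2 * M) ≤ s ^ 8 * κ + s ^ 7 * M := by
    have : s ^ 6 * M ≤ s ^ 7 * M := by gcongr
    linarith
  have t6 : (s ^ 4) ^ 2 * (κ + 11 * M * s⁻¹) = s ^ 8 * κ + 11 * s ^ 7 * M := by
    field_simp
  rw [t2, t6]
  have : 0 ≤ s ^ 7 * M := by positivity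
  linarith

/-! ### Cut norms of step functions and of matrices -/

section cutNorm

variable {W W' : unitInterval × unitInterval → ℝ}

theorem abs_setIntegral_le_cutNorm (hW : Integrable W) {S T : Set unitInterval}
    (hS : MeasurableSet S) (hT : MeasurableSet T) : |∫ z in S ×ˢ T, W z| ≤ cutNorm W := by
  refine le_csSup ⟨∫ z, |W z|, ?_⟩ ⟨S, T, hS, hT, rfl⟩
  rintro _ ⟨S', T', -, -, rfl⟩
  exact abs_integral_le_integral_abs.trans
    (setIntegral_le_integral hW.abs (.of_forall fun z => abs_nonneg _))

theorem cutNorm_le {c : ℝ} (h : ∀ S T : Set unitInterval, MeasurableSet S → MeasurableSet T →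
    |∫ z in S ×ˢ T, W z| ≤ c) : cutNorm W ≤ c := by
  refine csSup_le ⟨_, ∅, ∅, .empty, .empty, rfl⟩ ?_
  rintro _ ⟨S, T, hS, hT, rfl⟩
  exact h S T hS hT

theorem cutNorm_nonneg (W : unitInterval × unitInterval → ℝ) : 0 ≤ cutNorm W := by
  refine Real.sSup_nonneg ?_
  rintro _ ⟨S, T, -, -, rfl⟩
  exact abs_nonneg _

theorem cutNorm_congr_ae (h : W =ᵐ[volume] W') : cutNorm W = cutNorm W' := by
  unfold cutNorm
  congr 1
  ext r
  refine exists_congr fun S => exists_congr fun T => ?_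
  rw [integral_congr_ae (ae_restrict_of_ae h)]

end cutNorm

/-- A linear form on a cube is bounded by its value at a vertex. -/
theorem exists_abs_sum_mul_le {ι : Type*} [Fintype ι] {c : ℝ} {a : ι → ℝ}
    (ha0 : ∀ i, 0 ≤ a i) (hac : ∀ i, a i ≤ c) (v : ι → ℝ) :
    ∃ S : Finset ι, |∑ i, a i * v i| ≤ c * |∑ i ∈ S, v i| := by
  classical
  rcases le_total 0 (∑ i, a i * v i) with h | h
  · refine ⟨Finset.univ.filter fun i => 0 < v i, ?_⟩
    rw [abs_of_nonneg h, abs_of_nonneg (Finset.sum_nonneg fun i hi => (Finset.mem_filter.1 hi).2.le),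
      Finset.sum_filter, Finset.mul_sum]
    refine Finset.sum_le_sum fun i _ => ?_
    split_ifs with hv
    · exact mul_le_mul_of_nonneg_right (hac i) hv.le
    · nlinarith [ha0 i, hac i]
  · refine ⟨Finset.univ.filter fun i => v i < 0, ?_⟩
    rw [abs_of_nonpos h, abs_of_nonpos (Finset.sum_nonpos fun i hi => (Finset.mem_filter.1 hi).2.le),
      Finset.sum_filter, mul_neg, neg_le_neg_iff, Finset.mul_sum]
    refine Finset.sum_le_sum fun i _ => ?_
    split_ifs with hv
    · exact mul_le_mul_of_nonpos_right (hac i) hv.le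
    · nlinarith [ha0 i, hac i]

/-- A bilinear form on a cube is bounded by its values at the vertices. -/
theorem abs_sum_mul_mul_le_matrixCut {k : ℕ} (B : Fin k → Fin k → ℝ) {c : ℝ} (hc : 0 ≤ c)
    {a b : Fin k → ℝ} (ha0 : ∀ i, 0 ≤ a i) (hac : ∀ i, a i ≤ c) (hb0 : ∀ i, 0 ≤ b i)
    (hbc : ∀ i, b i ≤ c) : |∑ i, ∑ j, a i * b j * B i j| ≤ c ^ 2 * matrixCut B := by
  obtain ⟨S, hS⟩ := exists_abs_sum_mul_le ha0 hac fun i => ∑ j, b j * B i j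
  obtain ⟨T, hT⟩ := exists_abs_sum_mul_le hb0 hbc fun j => ∑ i ∈ S, B i j
  have e1 : ∑ i, ∑ j, a i * b j * B i j = ∑ i, a i * ∑ j, b j * B i j := by
    simp_rw [Finset.mul_sum, mul_assoc]
  have e2 : ∑ i ∈ S, ∑ j, b j * B i j = ∑ j, b j * ∑ i ∈ S, B i j := by
    rw [Finset.sum_comm]; simp_rw [Finset.mul_sum]
  rw [e1]
  rw [e2] at hS
  rw [Finset.sum_comm] at hT
  calc _ ≤ c * (c * |∑ i ∈ S, ∑ j ∈ T, B i j|) := hS.trans (by gcongr)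
    _ ≤ c * (c * matrixCut B) := by gcongr; exact le_matrixCut B S T
    _ = _ := by ring

section step

variable {k : ℕ}

theorem measurableSet_step (i : Fin k) : MeasurableSet (step k i) :=
  (measurableSet_le measurable_const measurable_subtype_coe).inter
    (measurableSet_lt measurable_subtype_coe measurable_const)

theorem measureReal_step (i : Fin k) : (volume : Measure unitInterval).real (step k i) = 1 / k := by
  have hk : (0 : ℝ) < k := by exact_mod_cast i.pos
  have hi : (i : ℝ) + 1 ≤ k := by exact_mod_cast i.isLt
  have himg : Subtype.val '' step k i = Set.Ico ((i : ℝ) / k) (((i : ℝ) + 1) / k) := by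
    ext x
    constructor
    · rintro ⟨y, hy, rfl⟩; exact hy
    · intro hx
      have h0 : 0 ≤ x := (by positivity : (0 : ℝ) ≤ (i : ℝ) / k).trans hx.1
      have h1 : x ≤ 1 := hx.2.le.trans ((div_le_one hk).2 hi)
      exact ⟨⟨x, h0, h1⟩, hx, rfl⟩
  rw [Measure.real, unitInterval.volume_apply, himg, Real.volume_Ico,
    ENNReal.toReal_ofReal (by rw [← sub_div]; simp)]
  ring

theorem disjoint_step {i j : Fin k} (h : i ≠ j) : Disjoint (step k i) (step k j) := by
  have hk : (0 : ℝ) < k := by exact_mod_cast i.pos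
  rw [Set.disjoint_left]
  rintro x ⟨h1, h2⟩ ⟨h3, h4⟩
  rw [div_le_iff₀ hk] at h1 h3
  rw [lt_div_iff₀ hk] at h2 h4
  have h5 : (i : ℝ) < j + 1 := by linarith
  have h6 : (j : ℝ) < i + 1 := by linarith
  norm_cast at h5 h6
  exact h (Fin.ext (by omega))

theorem sampleKernel_eq (U : unitInterval × unitInterval → ℝ) (x : Fin k → unitInterval)
    (z : unitInterval × unitInterval) : sampleKernel U x z =
      ∑ i, ∑ j, (step k i ×ˢ step k j).indicator (fun _ => sampleMatrix U x i j) z := by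
  unfold sampleKernel
  refine Finset.sum_congr rfl fun i _ => Finset.sum_congr rfl fun j _ => ?_
  by_cases hij : i = j
  · simp [sampleMatrix, hij]
  · by_cases hz : z ∈ step k i ×ˢ step k j
    · rw [Set.indicator_of_mem hz, if_pos ⟨hij, hz⟩, sampleMatrix, if_neg hij]
    · rw [Set.indicator_of_notMem hz, if_neg fun h => hz h.2]

theorem integrable_sampleKernel (U : unitInterval × unitInterval → ℝ) (x : Fin k → unitInterval) :
    Integrable (sampleKernel U x) := by
  have : sampleKernel U x = fun z =>
      ∑ i, ∑ j, (step k i ×ˢ step k j).indicator (fun _ => sampleMatrix U x i j) z :=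
    funext (sampleKernel_eq U x)
  rw [this]
  exact integrable_finsetSum _ fun i _ => integrable_finsetSum _ fun j _ =>
    (integrable_const _).indicator ((measurableSet_step i).prod (measurableSet_step j))

theorem setIntegral_sampleKernel (U : unitInterval × unitInterval → ℝ) (x : Fin k → unitInterval)
    (S T : Set unitInterval) : ∫ z in S ×ˢ T, sampleKernel U x z = ∑ i, ∑ j,
      (volume : Measure unitInterval).real (step k i ∩ S) *
        (volume : Measure unitInterval).real (step k j ∩ T) * sampleMatrix U x i j := by
  have hst : ∀ i j : Fin k, MeasurableSet (step k i ×ˢ step k j) := fun i j =>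
    (measurableSet_step i).prod (measurableSet_step j)
  simp_rw [sampleKernel_eq]
  have hi : ∀ i j : Fin k, Integrable (fun z : unitInterval × unitInterval =>
      (step k i ×ˢ step k j).indicator (fun _ => sampleMatrix U x i j) z)
      (volume.restrict (S ×ˢ T)) := fun i j => (integrable_const _).indicator (hst i j)
  rw [integral_finsetSum _ fun i _ => integrable_finsetSum _ fun j _ => hi i j]
  refine Finset.sum_congr rfl fun i _ => ?_
  rw [integral_finsetSum _ fun j _ => hi i j]
  refine Finset.sum_congr rfl fun j _ => ?_
  rw [integral_indicator_const _ (hst i j), measureReal_restrict_apply (hst i j),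
    Set.prod_inter_prod, smul_eq_mul, Measure.volume_eq_prod, measureReal_prod_prod]

/-- The cut norm of the step function of a sample is the normalized cut norm of its matrix. -/
theorem cutNorm_sampleKernel (hk : 0 < k) (U : unitInterval × unitInterval → ℝ)
    (x : Fin k → unitInterval) :
    cutNorm (sampleKernel U x) = matrixCut (sampleMatrix U x) / k ^ 2 := by
  have hk' : (0 : ℝ) < k := by exact_mod_cast hk
  apply le_antisymm
  · refine cutNorm_le fun S T hS hT => ?_
    rw [setIntegral_sampleKernel U x S T]
    have hle : ∀ (S : Set unitInterval) (i : Fin k),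
        (volume : Measure unitInterval).real (step k i ∩ S) ≤ 1 / k := fun S i => by
      rw [← measureReal_step i]; exact measureReal_mono Set.inter_subset_left
    refine (abs_sum_mul_mul_le_matrixCut _ (by positivity) (fun i => measureReal_nonneg) (hle S)
      (fun i => measureReal_nonneg) (hle T)).trans (le_of_eq ?_)
    ring
  · rw [div_le_iff₀ (by positivity)]
    refine Finset.sup'_le _ _ fun r _ => ?_
    have hm : ∀ R : Finset (Fin k), MeasurableSet (⋃ i ∈ R, step k i) := fun R =>
      R.measurableSet_biUnion fun i _ => measurableSet_step i
    have hv : ∀ (R : Finset (Fin k)) (i : Fin k), (volume : Measure unitInterval).real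
        (step k i ∩ ⋃ l ∈ R, step k l) = if i ∈ R then (1 / k : ℝ) else 0 := by
      intro R i
      split_ifs with h
      · have : step k i ⊆ ⋃ l ∈ R, step k l := fun y hy => Set.mem_iUnion₂.2 ⟨i, h, hy⟩
        rw [Set.inter_eq_left.2 this, measureReal_step]
      · have : step k i ∩ ⋃ l ∈ R, step k l = ∅ := by
          rw [← Set.disjoint_iff_inter_eq_empty, Set.disjoint_iUnion₂_right]
          exact fun l hl => disjoint_step fun e => h (e ▸ hl)
        rw [this, measureReal_empty]
    have h := abs_setIntegral_le_cutNorm (integrable_sampleKernel U x) (hm r.1) (hm r.2)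
    rw [setIntegral_sampleKernel] at h
    simp_rw [hv] at h
    have e : ∑ i, ∑ j, (if i ∈ r.1 then (1 / k : ℝ) else 0) * (if j ∈ r.2 then (1 / k : ℝ) else 0) *
        sampleMatrix U x i j = (∑ i ∈ r.1, ∑ j ∈ r.2, sampleMatrix U x i j) / k ^ 2 := by
      have e1 : ∀ i, ∑ j, (if i ∈ r.1 then (1 / k : ℝ) else 0) * (if j ∈ r.2 then (1 / k : ℝ) else 0) *
          sampleMatrix U x i j =
          if i ∈ r.1 then (∑ j ∈ r.2, sampleMatrix U x i j) / k ^ 2 else 0 := by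
        intro i
        split_ifs
        · have e2 : ∀ j, (1 / k : ℝ) * (if j ∈ r.2 then (1 / k : ℝ) else 0) *
              sampleMatrix U x i j = if j ∈ r.2 then sampleMatrix U x i j / k ^ 2 else 0 := by
            intro j
            split_ifs
            · field_simp
            · simp
          simp_rw [e2]
          rw [Finset.sum_ite_mem, Finset.univ_inter, Finset.sum_div]
        · simp
      simp_rw [e1]
      rw [Finset.sum_ite_mem, Finset.univ_inter, Finset.sum_div]
    rw [e, abs_div, abs_of_pos (by positivity : (0 : ℝ) < k ^ 2), div_le_iff₀ (by positivity)] at h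
    exact h

end step

/-- The cut norm of a square matrix with truncation: only those rectangles `S × T` count for which
the principal submatrix with index set `S ∪ T` has all its absolute row sums at most `c`. Unlike
`matrixCut` it changes by at most `2 * c` when a row and the corresponding column of a symmetric
matrix are changed. -/
def truncCut {k : ℕ} (c : ℝ) (B : Fin k → Fin k → ℝ) : ℝ :=
  Finset.univ.sup' Finset.univ_nonempty fun r : Finset (Fin k) × Finset (Fin k) =>
    if ∀ i ∈ r.1 ∪ r.2, ∑ j ∈ r.1 ∪ r.2, |B i j| ≤ c then |∑ i ∈ r.1, ∑ j ∈ r.2, B i j| else 0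

section truncCut

variable {k : ℕ} {c : ℝ} {B B' : Fin k → Fin k → ℝ}

theorem le_truncCut {S T : Finset (Fin k)} (h : ∀ i ∈ S ∪ T, ∑ j ∈ S ∪ T, |B i j| ≤ c) :
    |∑ i ∈ S, ∑ j ∈ T, B i j| ≤ truncCut c B := by
  have := Finset.le_sup' (fun r : Finset (Fin k) × Finset (Fin k) =>
    if ∀ i ∈ r.1 ∪ r.2, ∑ j ∈ r.1 ∪ r.2, |B i j| ≤ c then |∑ i ∈ r.1, ∑ j ∈ r.2, B i j| else 0)
    (Finset.mem_univ (S, T))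
  simp only at this
  rwa [if_pos h] at this

theorem truncCut_nonneg : 0 ≤ truncCut c B := by
  have := le_truncCut (c := c) (B := B) (S := ∅) (T := ∅) (by simp)
  simpa using this

theorem truncCut_le_matrixCut : truncCut c B ≤ matrixCut B := by
  refine Finset.sup'_le _ _ fun r _ => ?_
  split_ifs
  · exact le_matrixCut B r.1 r.2
  · exact matrixCut_nonneg B

theorem matrixCut_le_truncCut (h : ∀ i, ∑ j, |B i j| ≤ c) : matrixCut B ≤ truncCut c B :=
  Finset.sup'_le _ _ fun _ _ => le_truncCut fun i _ =>
    (Finset.sum_le_sum_of_subset_of_nonneg (Finset.subset_univ _) fun _ _ _ => abs_nonneg _).trans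
      (h i)

theorem truncCut_le_add (hc : 0 ≤ c) (hB : ∀ i j, B i j = B j i) (m : Fin k)
    (hBB' : ∀ i j, i ≠ m → j ≠ m → B i j = B' i j) : truncCut c B ≤ truncCut c B' + 2 * c := by
  refine Finset.sup'_le _ _ fun r _ => ?_
  have h0 := truncCut_nonneg (c := c) (B := B')
  split_ifs with h
  swap; · linarith
  obtain ⟨S, T⟩ := r
  simp only at h ⊢
  by_cases hm : m ∈ S ∪ T
  · have hrow : ∑ j ∈ S ∪ T, |B m j| ≤ c := h m hm
    have hS : ∑ j ∈ T, |B m j| ≤ c := (Finset.sum_le_sum_of_subset_of_nonneg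
      Finset.subset_union_right fun _ _ _ => abs_nonneg _).trans hrow
    have hT : ∑ i ∈ S.erase m, |B i m| ≤ c := by
      simp_rw [fun i => hB i m]
      exact (Finset.sum_le_sum_of_subset_of_nonneg ((Finset.erase_subset _ _).trans
        Finset.subset_union_left) fun _ _ _ => abs_nonneg _).trans hrow
    have e1 : |∑ i ∈ S, ∑ j ∈ T, B i j| ≤ |∑ i ∈ S.erase m, ∑ j ∈ T, B i j| + c := by
      by_cases hmS : m ∈ S
      · rw [← Finset.add_sum_erase S _ hmS, add_comm]
        refine (abs_add_le _ _).trans (add_le_add le_rfl ?_)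
        exact (Finset.abs_sum_le_sum_abs _ _).trans hS
      · rw [Finset.erase_eq_of_notMem hmS]; linarith
    have e2 : |∑ i ∈ S.erase m, ∑ j ∈ T, B i j| ≤
        |∑ i ∈ S.erase m, ∑ j ∈ T.erase m, B i j| + c := by
      by_cases hmT : m ∈ T
      · have : ∑ i ∈ S.erase m, ∑ j ∈ T, B i j =
            ∑ i ∈ S.erase m, ∑ j ∈ T.erase m, B i j + ∑ i ∈ S.erase m, B i m := by
          rw [← Finset.sum_add_distrib]
          refine Finset.sum_congr rfl fun i _ => ?_
          rw [← Finset.add_sum_erase T _ hmT, add_comm]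
        rw [this]
        refine (abs_add_le _ _).trans (add_le_add le_rfl ?_)
        exact (Finset.abs_sum_le_sum_abs _ _).trans hT
      · rw [Finset.erase_eq_of_notMem hmT]; linarith
    have hne : ∀ {R : Finset (Fin k)} {i}, i ∈ R.erase m → i ≠ m := fun h =>
      (Finset.mem_erase.1 h).1
    have e3 : ∑ i ∈ S.erase m, ∑ j ∈ T.erase m, B i j =
        ∑ i ∈ S.erase m, ∑ j ∈ T.erase m, B' i j :=
      Finset.sum_congr rfl fun i hi => Finset.sum_congr rfl fun j hj =>
        hBB' i j (hne hi) (hne hj)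
    have e4 : |∑ i ∈ S.erase m, ∑ j ∈ T.erase m, B' i j| ≤ truncCut c B' := by
      refine le_truncCut fun i hi => ?_
      rw [← Finset.erase_union_distrib] at hi ⊢
      calc _ = ∑ j ∈ (S ∪ T).erase m, |B i j| := Finset.sum_congr rfl fun j hj => by
            rw [hBB' i j (hne hi) (hne hj)]
        _ ≤ ∑ j ∈ S ∪ T, |B i j| := Finset.sum_le_sum_of_subset_of_nonneg
            (Finset.erase_subset _ _) fun _ _ _ => abs_nonneg _
        _ ≤ c := h i (Finset.mem_of_mem_erase hi)
    rw [e3] at e2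
    linarith
  · have hne : ∀ i ∈ S ∪ T, i ≠ m := fun i hi e => hm (e ▸ hi)
    have e3 : ∑ i ∈ S, ∑ j ∈ T, B i j = ∑ i ∈ S, ∑ j ∈ T, B' i j :=
      Finset.sum_congr rfl fun i hi => Finset.sum_congr rfl fun j hj =>
        hBB' i j (hne i (Finset.mem_union_left _ hi)) (hne j (Finset.mem_union_right _ hj))
    have e4 : |∑ i ∈ S, ∑ j ∈ T, B' i j| ≤ truncCut c B' := by
      refine le_truncCut fun i hi => le_trans (le_of_eq ?_) (h i hi)
      exact Finset.sum_congr rfl fun j hj => by rw [hBB' i j (hne i hi) (hne j hj)]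
    rw [e3]
    linarith

/-- Deleting the rows with large absolute row sum, and the corresponding columns, shows that
truncation loses at most twice the sum of the large row sums. -/
theorem abs_sum_le_truncCut_add (hB : ∀ i j, B i j = B j i) (S T : Finset (Fin k)) :
    |∑ i ∈ S, ∑ j ∈ T, B i j| ≤
      truncCut c B + 2 * ∑ i, if c < ∑ j, |B i j| then ∑ j, |B i j| else 0 := by
  set D : Finset (Fin k) := Finset.univ.filter fun i => c < ∑ j, |B i j| with hD
  rw [← Finset.sum_filter, ← hD]
  have hgood : |∑ i ∈ S \ D, ∑ j ∈ T \ D, B i j| ≤ truncCut c B := by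
    refine le_truncCut fun i hi => ?_
    have : i ∉ D := by
      rw [Finset.mem_union, Finset.mem_sdiff, Finset.mem_sdiff] at hi
      tauto
    have h2 : ∑ j, |B i j| ≤ c := by simpa [hD] using this
    exact (Finset.sum_le_sum_of_subset_of_nonneg (Finset.subset_univ _)
      fun _ _ _ => abs_nonneg _).trans h2
  have hrows : |∑ i ∈ S ∩ D, ∑ j ∈ T, B i j| ≤ ∑ i ∈ D, ∑ j, |B i j| := by
    refine (Finset.abs_sum_le_sum_abs _ _).trans ?_
    refine (Finset.sum_le_sum fun i _ => Finset.abs_sum_le_sum_abs _ _).trans ?_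
    refine (Finset.sum_le_sum fun i _ => Finset.sum_le_sum_of_subset_of_nonneg
      (Finset.subset_univ T) fun _ _ _ => abs_nonneg _).trans ?_
    exact Finset.sum_le_sum_of_subset_of_nonneg Finset.inter_subset_right
      fun _ _ _ => Finset.sum_nonneg fun _ _ => abs_nonneg _
  have hcols : |∑ i ∈ S \ D, ∑ j ∈ T ∩ D, B i j| ≤ ∑ i ∈ D, ∑ j, |B i j| := by
    rw [Finset.sum_comm]
    simp_rw [fun i j => hB i j]
    refine (Finset.abs_sum_le_sum_abs _ _).trans ?_
    refine (Finset.sum_le_sum fun i _ => Finset.abs_sum_le_sum_abs _ _).trans ?_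
    refine (Finset.sum_le_sum fun i _ => Finset.sum_le_sum_of_subset_of_nonneg
      (Finset.subset_univ _) fun _ _ _ => abs_nonneg _).trans ?_
    refine (Finset.sum_le_sum_of_subset_of_nonneg Finset.inter_subset_right
      fun _ _ _ => Finset.sum_nonneg fun _ _ => abs_nonneg _).trans (le_of_eq ?_)
    exact Finset.sum_congr rfl fun i _ => Finset.sum_congr rfl fun j _ => by rw [hB]
  have hsplit : ∑ i ∈ S, ∑ j ∈ T, B i j = ∑ i ∈ S ∩ D, ∑ j ∈ T, B i j +
      (∑ i ∈ S \ D, ∑ j ∈ T ∩ D, B i j + ∑ i ∈ S \ D, ∑ j ∈ T \ D, B i j) := by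
    rw [← Finset.sum_inter_add_sum_sdiff S D, ← Finset.sum_add_distrib]
    congr 1
    exact Finset.sum_congr rfl fun i _ => (Finset.sum_inter_add_sum_sdiff T D _).symm
  rw [hsplit]
  have h1 := abs_add_le (∑ i ∈ S ∩ D, ∑ j ∈ T, B i j)
    (∑ i ∈ S \ D, ∑ j ∈ T ∩ D, B i j + ∑ i ∈ S \ D, ∑ j ∈ T \ D, B i j)
  have h2 := abs_add_le (∑ i ∈ S \ D, ∑ j ∈ T ∩ D, B i j) (∑ i ∈ S \ D, ∑ j ∈ T \ D, B i j)
  linarith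

end truncCut

theorem matrixCut_le_add {k : ℕ} (B B' : Fin k → Fin k → ℝ) :
    matrixCut B ≤ matrixCut B' + ∑ i, ∑ j, |B i j - B' i j| := by
  refine Finset.sup'_le _ _ fun r _ => ?_
  have h1 := le_matrixCut B' r.1 r.2
  have h2 : |∑ i ∈ r.1, ∑ j ∈ r.2, (B i j - B' i j)| ≤ ∑ i, ∑ j, |B i j - B' i j| := by
    refine (Finset.abs_sum_le_sum_abs _ _).trans ?_
    refine (Finset.sum_le_sum fun i _ => Finset.abs_sum_le_sum_abs _ _).trans ?_
    refine (Finset.sum_le_sum fun i _ => Finset.sum_le_sum_of_subset_of_nonneg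
      (Finset.subset_univ _) fun _ _ _ => abs_nonneg _).trans ?_
    exact Finset.sum_le_sum_of_subset_of_nonneg (Finset.subset_univ _)
      fun _ _ _ => Finset.sum_nonneg fun _ _ => abs_nonneg _
  have h3 : ∑ i ∈ r.1, ∑ j ∈ r.2, B i j =
      ∑ i ∈ r.1, ∑ j ∈ r.2, B' i j + ∑ i ∈ r.1, ∑ j ∈ r.2, (B i j - B' i j) := by
    simp_rw [Finset.sum_sub_distrib]; ring
  rw [h3]
  exact (abs_add_le _ _).trans (add_le_add h1 h2)

/-! ### Sampling unbounded kernels: moments, truncation and tails -/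

section sample

variable {α : Type*} {k : ℕ}

theorem sampleMatrix_symm {g : α × α → ℝ} (hg : ∀ z, g z.swap = g z) (x : Fin k → α)
    (i j : Fin k) : sampleMatrix g x i j = sampleMatrix g x j i := by
  unfold sampleMatrix
  simp only [eq_comm (a := j)]
  split_ifs
  · rfl
  · exact (hg (x i, x j)).symm

theorem sampleMatrix_update {g : α × α → ℝ} (x : Fin k → α) (m : Fin k) (a : α) {i j : Fin k}
    (hi : i ≠ m) (hj : j ≠ m) :
    sampleMatrix g (Function.update x m a) i j = sampleMatrix g x i j := by
  simp [sampleMatrix, Function.update_of_ne hi, Function.update_of_ne hj]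

theorem truncCut_sampleMatrix_update_le {U : α × α → ℝ} (hsymm : ∀ z, U z.swap = U z) {c : ℝ} (hc : 0 ≤ c)
    (x : Fin k → α) (m : Fin k) (a : α) : truncCut c (sampleMatrix U (Function.update x m a)) ≤
      truncCut c (sampleMatrix U x) + 2 * c :=
  truncCut_le_add hc (sampleMatrix_symm hsymm _) m fun _ _ hi hj => sampleMatrix_update x m a hi hj

variable [MeasurableSpace α] {g : α × α → ℝ}

theorem measurable_matrixCut_sampleMatrix (hg : Measurable g) :
    Measurable fun x : Fin k → α => matrixCut (sampleMatrix g x) := by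
  have := Finset.measurable_sup' (s := Finset.univ)
    (f := fun (r : Finset (Fin k) × Finset (Fin k)) (x : Fin k → α) =>
      |∑ i ∈ r.1, ∑ j ∈ r.2, sampleMatrix g x i j|) Finset.univ_nonempty fun r _ => by
        refine Measurable.abs ?_
        exact Finset.measurable_fun_sum _ fun i _ => Finset.measurable_fun_sum _ fun j _ =>
          measurable_sampleMatrix hg i j
  convert this using 1
  ext x; simp [matrixCut]

theorem measurable_truncCut_sampleMatrix (hg : Measurable g) (c : ℝ) :
    Measurable fun x : Fin k → α => truncCut c (sampleMatrix g x) := by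
  have hB := fun i j => measurable_sampleMatrix (k := k) hg i j
  have := Finset.measurable_sup' (s := Finset.univ)
    (f := fun (r : Finset (Fin k) × Finset (Fin k)) (x : Fin k → α) =>
      if ∀ i ∈ r.1 ∪ r.2, ∑ j ∈ r.1 ∪ r.2, |sampleMatrix g x i j| ≤ c then
        |∑ i ∈ r.1, ∑ j ∈ r.2, sampleMatrix g x i j| else 0) Finset.univ_nonempty fun r _ => by
        refine Measurable.ite ?_ (Measurable.abs ?_) measurable_const
        · have : {x : Fin k → α | ∀ i ∈ r.1 ∪ r.2, ∑ j ∈ r.1 ∪ r.2, |sampleMatrix g x i j| ≤ c} =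
              ⋂ i ∈ r.1 ∪ r.2, {x | ∑ j ∈ r.1 ∪ r.2, |sampleMatrix g x i j| ≤ c} := by
            ext x; simp
          rw [this]
          refine Finset.measurableSet_biInter _ fun i _ => measurableSet_le ?_ measurable_const
          exact Finset.measurable_fun_sum _ fun j _ => (hB i j).abs
        · exact Finset.measurable_fun_sum _ fun i _ => Finset.measurable_fun_sum _ fun j _ =>
            hB i j
  convert this using 1
  ext x; simp [truncCut]

variable (ν : Measure α) [IsProbabilityMeasure ν]

theorem integrable_sampleMatrix (hg : Integrable g (ν.prod ν)) (i j : Fin k) :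
    Integrable (fun x => sampleMatrix g x i j) (Measure.pi fun _ => ν) := by
  unfold sampleMatrix
  split_ifs with h
  · exact integrable_const 0
  · exact (measurePreserving_eval_pair ν h).integrable_comp_of_integrable hg

theorem integral_sampleMatrix (hg : Integrable g (ν.prod ν)) (i j : Fin k) :
    ∫ x, sampleMatrix g x i j ∂(Measure.pi fun _ => ν) =
      if i = j then 0 else ∫ z, g z ∂(ν.prod ν) := by
  unfold sampleMatrix
  split_ifs with h
  · simp
  · have hp := measurePreserving_eval_pair ν h
    have hg' : AEStronglyMeasurable g
        (Measure.map (fun x : Fin k → α => (x i, x j)) (Measure.pi fun _ => ν)) := by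
      rw [hp.map_eq]; exact hg.aestronglyMeasurable
    rw [← integral_map (φ := fun x : Fin k → α => (x i, x j)) hp.measurable.aemeasurable hg',
      hp.map_eq]

theorem integral_sampleMatrix_le (hg : Integrable g (ν.prod ν)) (hg0 : ∀ z, 0 ≤ g z)
    (i j : Fin k) :
    ∫ x, sampleMatrix g x i j ∂(Measure.pi fun _ => ν) ≤ ∫ z, g z ∂(ν.prod ν) := by
  rw [integral_sampleMatrix ν hg]
  split_ifs
  · exact integral_nonneg hg0
  · exact le_rfl

theorem matrixCut_le_sum (B : Fin k → Fin k → ℝ) : matrixCut B ≤ ∑ i, ∑ j, |B i j| := by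
  have h := matrixCut_le_add B 0
  have h0 : matrixCut (0 : Fin k → Fin k → ℝ) = 0 :=
    le_antisymm (Finset.sup'_le _ _ fun r _ => by simp) (matrixCut_nonneg _)
  simpa [h0] using h

theorem integrable_matrixCut_sampleMatrix (hgm : Measurable g) (hg : Integrable g (ν.prod ν)) :
    Integrable (fun x : Fin k → α => matrixCut (sampleMatrix g x)) (Measure.pi fun _ => ν) := by
  have hs : Integrable (fun x : Fin k → α => ∑ i, ∑ j, |sampleMatrix g x i j|)
      (Measure.pi fun _ => ν) :=
    integrable_finsetSum _ fun i _ => integrable_finsetSum _ fun j _ =>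
      (integrable_sampleMatrix ν hg i j).abs
  refine hs.mono' (measurable_matrixCut_sampleMatrix hgm).aestronglyMeasurable
    (.of_forall fun x => ?_)
  rw [Real.norm_of_nonneg (matrixCut_nonneg _)]
  exact matrixCut_le_sum _

end sample

/-- The pointwise bound behind truncation in `L^p` at level `M`. -/
theorem le_rpow_div_rpow {p M a : ℝ} (hp : 1 < p) (hM : 0 < M) (ha : M < a) :
    a ≤ a ^ p / M ^ (p - 1) := by
  have ha0 : 0 < a := hM.trans ha
  rw [le_div_iff₀ (by positivity)]
  calc a * M ^ (p - 1) ≤ a * a ^ (p - 1) := by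
        gcongr
    _ = a ^ p := by rw [← Real.rpow_one_add' ha0.le (by linarith)]; ring_nf

section moment

variable {α : Type*} [MeasurableSpace α] {k : ℕ} (ν : Measure α) [IsProbabilityMeasure ν]
  {U : α × α → ℝ} {p N : ℝ}

/-- The expected cut norm of a `k`-sample of an `L^p` kernel. The kernel is truncated at the level
`N * k ^ (1 / (4 * p))`, at which the loss in the truncation and the error bound for bounded kernels
are of the same order. -/
theorem integral_matrixCut_le (hk : 0 < k) (hUm : Measurable U) (hU : Integrable U (ν.prod ν))
    (hp : 1 < p) (hN : 0 < N) (hUp : Integrable (fun z => |U z| ^ p) (ν.prod ν))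
    (hNp : ∫ z, |U z| ^ p ∂(ν.prod ν) ≤ N ^ p) {κ : ℝ}
    (hκ : ∀ A D : Set α, MeasurableSet A → MeasurableSet D →
      |∫ z in A ×ˢ D, U z ∂(ν.prod ν)| ≤ κ) :
    ∫ x, matrixCut (sampleMatrix U x) ∂(Measure.pi fun _ : Fin k => ν) ≤
      k ^ 2 * (κ + 13 * N * (k : ℝ) ^ (-(1 / 4) + 1 / (4 * p))) := by
  have hk0 : (0 : ℝ) < k := by exact_mod_cast hk
  set M : ℝ := N * (k : ℝ) ^ (1 / (4 * p)) with hM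
  have hM0 : 0 < M := by positivity
  set E : ℝ := N * (k : ℝ) ^ (-(1 / 4) + 1 / (4 * p)) with hE
  have hME : M * (k : ℝ) ^ (-(1 / 4) : ℝ) = E := by
    rw [hM, hE, mul_assoc, ← Real.rpow_add hk0, add_comm]
  have hδ : N ^ p / M ^ (p - 1) = E := by
    have h1 : 1 / (4 * p) * (p - 1) = 1 / 4 - 1 / (4 * p) := by field_simp
    rw [hM, Real.mul_rpow hN.le (by positivity), ← Real.rpow_mul hk0.le, h1, hE, ← div_div,
      ← Real.rpow_sub hN, div_eq_mul_inv, ← Real.rpow_neg hk0.le]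
    norm_num
    left
    ring_nf
  set V : α × α → ℝ := fun z => if |U z| ≤ M then U z else 0 with hV
  have hVm : Measurable V :=
    Measurable.ite (measurableSet_le hUm.abs measurable_const) hUm measurable_const
  have hVb : ∀ z, |V z| ≤ M := fun z => by
    simp only [hV]; split_ifs with h
    · exact h
    · simpa using hM0.le
  have hVi : Integrable V (ν.prod ν) := integrable_of_abs_le hVm hVb
  have hUV : ∀ z, |U z - V z| ≤ |U z| ^ p / M ^ (p - 1) := fun z => by
    simp only [hV]; split_ifs with h
    · simp only [sub_self, abs_zero]; positivity
    · rw [sub_zero]; exact le_rpow_div_rpow hp hM0 (not_le.1 h)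
  have hdi : Integrable (fun z => |U z - V z|) (ν.prod ν) := (hU.sub hVi).abs
  have hd : ∫ z, |U z - V z| ∂(ν.prod ν) ≤ E := by
    calc _ ≤ ∫ z, |U z| ^ p / M ^ (p - 1) ∂(ν.prod ν) :=
          integral_mono hdi (hUp.div_const _) hUV
      _ ≤ N ^ p / M ^ (p - 1) := by rw [integral_div]; gcongr
      _ = E := hδ
  have hκV : ∀ A D : Set α, MeasurableSet A → MeasurableSet D →
      |∫ z in A ×ˢ D, V z ∂(ν.prod ν)| ≤ κ + E := by
    intro A D hA hD
    have h1 : ∫ z in A ×ˢ D, V z ∂(ν.prod ν) = ∫ z in A ×ˢ D, U z ∂(ν.prod ν) -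
        ∫ z in A ×ˢ D, (U z - V z) ∂(ν.prod ν) := by
      rw [integral_sub hU.integrableOn hVi.integrableOn]; ring
    have h2 : |∫ z in A ×ˢ D, (U z - V z) ∂(ν.prod ν)| ≤ E :=
      (abs_integral_le_integral_abs.trans
        (setIntegral_le_integral hdi (.of_forall fun z => abs_nonneg _))).trans hd
    rw [h1]
    exact (abs_sub _ _).trans (add_le_add (hκ A D hA hD) h2)
  have hbdd := integral_matrixCut_le_of_bounded hk hM0 ν hVm hVb hκV
  have hsub : ∀ (x : Fin k → α) i j, |sampleMatrix U x i j - sampleMatrix V x i j| =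
      sampleMatrix (fun z => |U z - V z|) x i j := fun x i j => by
    unfold sampleMatrix; split_ifs <;> simp
  have hsi : ∀ i j : Fin k, Integrable (fun x => sampleMatrix (fun z => |U z - V z|) x i j)
      (Measure.pi fun _ => ν) := fun i j => integrable_sampleMatrix ν hdi i j
  have hsum : Integrable (fun x : Fin k → α => ∑ i, ∑ j,
      sampleMatrix (fun z => |U z - V z|) x i j) (Measure.pi fun _ => ν) :=
    integrable_finsetSum _ fun i _ => integrable_finsetSum _ fun j _ => hsi i j
  have hVc := integrable_matrixCut_sampleMatrix (k := k) ν hVm hVi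
  have hE0 : 0 ≤ E := by positivity
  calc _ ≤ ∫ x, (matrixCut (sampleMatrix V x) +
          ∑ i, ∑ j, sampleMatrix (fun z => |U z - V z|) x i j)
            ∂(Measure.pi fun _ : Fin k => ν) := by
        refine integral_mono (integrable_matrixCut_sampleMatrix ν hUm hU) (hVc.add hsum)
          fun x => ?_
        have := matrixCut_le_add (sampleMatrix U x) (sampleMatrix V x)
        simpa only [hsub] using this
    _ ≤ k ^ 2 * (κ + E + 11 * M * (k : ℝ) ^ (-(1 / 4) : ℝ)) + k * (k * E) := by
        rw [integral_add hVc hsum, integral_finsetSum _ fun i _ =>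
          integrable_finsetSum _ fun j _ => hsi i j]
        refine add_le_add hbdd ?_
        refine sum_le_card_mul _ (card_le_fin _) (by positivity) fun i _ => ?_
        rw [integral_finsetSum _ fun j _ => hsi i j]
        refine sum_le_card_mul _ (card_le_fin _) (by positivity) fun j _ => ?_
        exact (integral_sampleMatrix_le ν hdi (fun z => abs_nonneg _) i j).trans hd
    _ = _ := by
        rw [mul_assoc 11, hME, mul_assoc 13, ← hE]; ring

/-- The normalized absolute row sums of a sample are bounded in `L^p` by the norm of the kernel. -/
theorem integral_rowSum_rpow_le (hk : 0 < k) (hp : 1 < p) (hUm : Measurable U)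
    (hUp : Integrable (fun z => |U z| ^ p) (ν.prod ν))
    (hNp : ∫ z, |U z| ^ p ∂(ν.prod ν) ≤ N ^ p) (hN : 0 < N) (i : Fin k) :
    Integrable (fun x => (∑ j, |sampleMatrix U x i j|) ^ p) (Measure.pi fun _ => ν) ∧
      ∫ x, (∑ j, |sampleMatrix U x i j|) ^ p ∂(Measure.pi fun _ => ν) ≤ (k : ℝ) ^ p * N ^ p := by
  have hk0 : (0 : ℝ) < k := by exact_mod_cast hk
  have hpow : ∀ (x : Fin k → α) j, |sampleMatrix U x i j| ^ p =
      sampleMatrix (fun z => |U z| ^ p) x i j := fun x j => by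
    unfold sampleMatrix; split_ifs
    · rw [abs_zero, Real.zero_rpow (by linarith)]
    · rfl
  have hle : ∀ x : Fin k → α, (∑ j, |sampleMatrix U x i j|) ^ p ≤
      (k : ℝ) ^ (p - 1) * ∑ j, sampleMatrix (fun z => |U z| ^ p) x i j := fun x => by
    have := Real.rpow_sum_le_const_mul_sum_rpow_of_nonneg (Finset.univ : Finset (Fin k))
      (f := fun j => |sampleMatrix U x i j|) hp.le fun j _ => abs_nonneg _
    simpa only [hpow, Finset.card_univ, Fintype.card_fin] using this
  have hi : ∀ j, Integrable (fun x => sampleMatrix (fun z => |U z| ^ p) x i j)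
    (Measure.pi fun _ : Fin k => ν) := fun j => integrable_sampleMatrix ν hUp i j
  have hsum : Integrable (fun x => (k : ℝ) ^ (p - 1) *
      ∑ j, sampleMatrix (fun z => |U z| ^ p) x i j) (Measure.pi fun _ : Fin k => ν) :=
    (integrable_finsetSum _ fun j _ => hi j).const_mul _
  have hint : Integrable (fun x => (∑ j, |sampleMatrix U x i j|) ^ p)
      (Measure.pi fun _ => ν) := by
    refine hsum.mono' ?_ (.of_forall fun x => ?_)
    · exact ((Finset.measurable_fun_sum _ fun j _ =>
        (measurable_sampleMatrix hUm i j).abs).pow_const p).aestronglyMeasurable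
    · rw [Real.norm_of_nonneg (Real.rpow_nonneg (Finset.sum_nonneg fun j _ => abs_nonneg _) _)]
      exact hle x
  refine ⟨hint, (integral_mono hint hsum hle).trans ?_⟩
  rw [integral_const_mul, integral_finsetSum _ fun j _ => hi j]
  calc _ ≤ (k : ℝ) ^ (p - 1) * (k * N ^ p) := by
        gcongr
        refine sum_le_card_mul _ (card_le_fin _) (by positivity) fun j _ => ?_
        exact (integral_sampleMatrix_le ν hUp (fun z => by positivity) i j).trans hNp
    _ = _ := by
        rw [← mul_assoc, ← Real.rpow_add_one hk0.ne']; ring_nf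

/-- Markov's inequality for the `p`-th powers of the row sums, and a union bound. -/
theorem measureReal_rowSum_gt_le (hk : 0 < k) (hp : 1 < p) (hUm : Measurable U)
    (hUp : Integrable (fun z => |U z| ^ p) (ν.prod ν))
    (hNp : ∫ z, |U z| ^ p ∂(ν.prod ν) ≤ N ^ p) (hN : 0 < N) {l : ℝ} (hl : 0 < l) :
    (Measure.pi fun _ : Fin k => ν).real {x | ∃ i, k * (N * l) < ∑ j, |sampleMatrix U x i j|} ≤
      k * l ^ (-p) := by
  have hk0 : (0 : ℝ) < k := by exact_mod_cast hk
  have hone : ∀ i : Fin k, (Measure.pi fun _ : Fin k => ν).real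
      {x | k * (N * l) < ∑ j, |sampleMatrix U x i j|} ≤ l ^ (-p) := by
    intro i
    obtain ⟨hint, hle⟩ := integral_rowSum_rpow_le ν hk hp hUm hUp hNp hN i
    have hmk := mul_meas_ge_le_integral_of_nonneg (.of_forall fun x => by positivity) hint
      ((k * (N * l)) ^ p)
    have hsub : (Measure.pi fun _ : Fin k => ν).real
        {x | k * (N * l) < ∑ j, |sampleMatrix U x i j|} ≤ (Measure.pi fun _ : Fin k => ν).real
        {x | (k * (N * l)) ^ p ≤ (∑ j, |sampleMatrix U x i j|) ^ p} := by
      refine measureReal_mono fun x hx => ?_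
      have hx' : k * (N * l) < ∑ j, |sampleMatrix U x i j| := hx
      exact Real.rpow_le_rpow (by positivity) hx'.le (by linarith)
    have h1 : (k * (N * l)) ^ p = (k : ℝ) ^ p * N ^ p * l ^ p := by
      rw [Real.mul_rpow hk0.le (by positivity), Real.mul_rpow hN.le hl.le, mul_assoc]
    rw [h1] at hmk hsub
    refine hsub.trans ?_
    have h2 : (0 : ℝ) < (k : ℝ) ^ p * N ^ p := by positivity
    have h3 : (0 : ℝ) < l ^ p := by positivity
    rw [Real.rpow_neg hl.le, ← one_div, le_div_iff₀ h3]
    refine le_of_mul_le_mul_left ?_ h2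
    linarith
  have : {x : Fin k → α | ∃ i, k * (N * l) < ∑ j, |sampleMatrix U x i j|} =
      ⋃ i, {x | k * (N * l) < ∑ j, |sampleMatrix U x i j|} := by ext x; simp
  rw [this]
  refine (measureReal_iUnion_fintype_le _).trans ?_
  exact sum_le_card_mul _ (card_le_fin _) (by positivity) fun i _ => hone i

theorem integrable_truncCut_sampleMatrix (hUm : Measurable U) (hsymm : ∀ z, U z.swap = U z)
    {c : ℝ} (hc : 0 ≤ c) :
    Integrable (fun x : Fin k → α => truncCut c (sampleMatrix U x)) (Measure.pi fun _ => ν) := by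
  obtain ⟨a₀⟩ : Nonempty α := nonempty_of_isProbabilityMeasure ν
  exact integrable_of_abs_le (measurable_truncCut_sampleMatrix hUm c)
    (abs_le_of_bounded_diff (truncCut_sampleMatrix_update_le hsymm hc) fun _ => a₀)

/-- Upper tail of the cut norm of a sample. The truncated cut norm has bounded differences, never
exceeds the cut norm, and agrees with it unless some row sum is large. -/
theorem measureReal_matrixCut_ge_le (hk : 0 < k) (hp : 1 < p) (hUm : Measurable U)
    (hU : Integrable U (ν.prod ν)) (hsymm : ∀ z, U z.swap = U z)
    (hUp : Integrable (fun z => |U z| ^ p) (ν.prod ν))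
    (hNp : ∫ z, |U z| ^ p ∂(ν.prod ν) ≤ N ^ p) (hN : 0 < N) {l : ℝ} (hl : 0 < l) {T : ℝ}
    (hT : 0 ≤ T) :
    (Measure.pi fun _ : Fin k => ν).real {x |
      ∫ y, matrixCut (sampleMatrix U y) ∂(Measure.pi fun _ : Fin k => ν) + T ≤
        matrixCut (sampleMatrix U x)} ≤
      k * l ^ (-p) + Real.exp (-(2 * T ^ 2 / (k * (2 * (k * (N * l))) ^ 2))) := by
  have hk0 : (0 : ℝ) < k := by exact_mod_cast hk
  have hc : 0 < k * (N * l) := by positivity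
  have htail := measureReal_ge_le_of_bounded_diff ν (c := 2 * (k * (N * l))) (by positivity) hk
    (measurable_truncCut_sampleMatrix hUm (k * (N * l)))
    (truncCut_sampleMatrix_update_le hsymm hc.le) hT
  have hmean : ∫ y, truncCut (k * (N * l)) (sampleMatrix U y) ∂(Measure.pi fun _ : Fin k => ν) ≤
      ∫ y, matrixCut (sampleMatrix U y) ∂(Measure.pi fun _ : Fin k => ν) :=
    integral_mono (integrable_truncCut_sampleMatrix ν hUm hsymm hc.le)
      (integrable_matrixCut_sampleMatrix ν hUm hU) fun x => truncCut_le_matrixCut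
  refine le_trans (measureReal_mono fun x hx => ?_) ((measureReal_union_le _ _).trans
    (add_le_add (measureReal_rowSum_gt_le ν hk hp hUm hUp hNp hN hl) htail))
  by_cases h : ∃ i, k * (N * l) < ∑ j, |sampleMatrix U x i j|
  · exact Or.inl h
  · push Not at h
    refine Or.inr ?_
    have h1 := matrixCut_le_truncCut h
    simp only [Set.mem_ofPred_eq] at hx ⊢
    linarith

/-- Lower tail of the cut norm of a sample, relative to the mean of the truncated cut norm. -/
theorem measureReal_matrixCut_le_le (hk : 0 < k) (hUm : Measurable U)
    (hsymm : ∀ z, U z.swap = U z) {c : ℝ} (hc : 0 < c) {T : ℝ} (hT : 0 ≤ T) :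
    (Measure.pi fun _ : Fin k => ν).real {x | matrixCut (sampleMatrix U x) ≤
      ∫ y, truncCut c (sampleMatrix U y) ∂(Measure.pi fun _ : Fin k => ν) - T} ≤
      Real.exp (-(2 * T ^ 2 / (k * (2 * c) ^ 2))) := by
  refine le_trans (measureReal_mono fun x hx => ?_)
    (measureReal_le_le_of_bounded_diff ν (c := 2 * c) (by positivity) hk
      (measurable_truncCut_sampleMatrix hUm c) (truncCut_sampleMatrix_update_le hsymm hc.le) hT)
  exact truncCut_le_matrixCut.trans hx

/-- The mean of the truncated cut norm is at least the mean of the sum over the rectangle of sample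
points in `A × D`, up to the mean of the large row sums. -/
theorem le_integral_truncCut (hk : 0 < k) (hp : 1 < p) (hUm : Measurable U)
    (hU : Integrable U (ν.prod ν)) (hsymm : ∀ z, U z.swap = U z)
    (hUp : Integrable (fun z => |U z| ^ p) (ν.prod ν))
    (hNp : ∫ z, |U z| ^ p ∂(ν.prod ν) ≤ N ^ p) (hN : 0 < N) {l : ℝ} (hl : 0 < l)
    {A D : Set α} (hA : MeasurableSet A) (hD : MeasurableSet D) :
    k * (k - 1) * |∫ z in A ×ˢ D, U z ∂(ν.prod ν)| - 2 * k ^ 2 * N * l ^ (1 - p) ≤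
      ∫ x, truncCut (k * (N * l)) (sampleMatrix U x) ∂(Measure.pi fun _ : Fin k => ν) := by
  classical
  have hk0 : (0 : ℝ) < k := by exact_mod_cast hk
  set c : ℝ := k * (N * l) with hcdef
  have hc : 0 < c := by positivity
  set μ := Measure.pi fun _ : Fin k => ν
  set g : α × α → ℝ := (A ×ˢ D).indicator U with hg
  have hgi : Integrable g (ν.prod ν) := hU.indicator (hA.prod hD)
  set big : Fin k → (Fin k → α) → ℝ := fun i x =>
    if c < ∑ j, |sampleMatrix U x i j| then ∑ j, |sampleMatrix U x i j| else 0 with hbig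
  have hbig_le : ∀ i x, big i x ≤ (∑ j, |sampleMatrix U x i j|) ^ p / c ^ (p - 1) := by
    intro i x
    simp only [hbig]
    split_ifs with h
    · exact le_rpow_div_rpow hp hc h
    · positivity
  have hbig0 : ∀ i x, 0 ≤ big i x := fun i x => by
    simp only [hbig]
    split_ifs
    · positivity
    · exact le_rfl
  have hbigm : ∀ i, Measurable (big i) := fun i => by
    have : Measurable fun x : Fin k → α => ∑ j, |sampleMatrix U x i j| :=
      Finset.measurable_fun_sum _ fun j _ => (measurable_sampleMatrix hUm i j).abs
    exact Measurable.ite (measurableSet_lt measurable_const this) this measurable_const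
  have hbigi : ∀ i, Integrable (big i) μ := fun i =>
    ((integral_rowSum_rpow_le ν hk hp hUm hUp hNp hN i).1.div_const _).mono'
      (hbigm i).aestronglyMeasurable (.of_forall fun x => by
        rw [Real.norm_of_nonneg (hbig0 i x)]; exact hbig_le i x)
  have hbigint : ∀ i, ∫ x, big i x ∂μ ≤ k * (N * l ^ (1 - p)) := by
    intro i
    obtain ⟨hint, hle⟩ := integral_rowSum_rpow_le ν hk hp hUm hUp hNp hN i
    calc ∫ x, big i x ∂μ ≤ ∫ x, (∑ j, |sampleMatrix U x i j|) ^ p / c ^ (p - 1) ∂μ :=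
          integral_mono (hbigi i) (hint.div_const _) (hbig_le i)
      _ ≤ (k : ℝ) ^ p * N ^ p / c ^ (p - 1) := by rw [integral_div]; gcongr
      _ = _ := by
          rw [hcdef, Real.mul_rpow hk0.le (by positivity), Real.mul_rpow hN.le hl.le,
            show 1 - p = -(p - 1) by ring, Real.rpow_neg hl.le]
          have e1 : (k : ℝ) ^ p = k ^ (p - 1) * k := by
            rw [← Real.rpow_add_one hk0.ne']; ring_nf
          have e2 : N ^ p = N ^ (p - 1) * N := by
            rw [← Real.rpow_add_one hN.ne']; ring_nf
          rw [e1, e2]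
          have h1 : (k : ℝ) ^ (p - 1) ≠ 0 := by positivity
          have h2 : N ^ (p - 1) ≠ 0 := by positivity
          have h3 : l ^ (p - 1) ≠ 0 := by positivity
          field_simp
  have hrect : ∀ x : Fin k → α, |∑ i, ∑ j, sampleMatrix g x i j| ≤
      truncCut c (sampleMatrix U x) + 2 * ∑ i, big i x := by
    intro x
    refine le_trans (le_of_eq ?_) (abs_sum_le_truncCut_add (sampleMatrix_symm hsymm x)
      (Finset.univ.filter fun i => x i ∈ A) (Finset.univ.filter fun j => x j ∈ D))
    congr 1
    rw [Finset.sum_filter]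
    refine Finset.sum_congr rfl fun i _ => ?_
    rw [Finset.sum_filter]
    by_cases hi : x i ∈ A
    · rw [if_pos hi]
      refine Finset.sum_congr rfl fun j _ => ?_
      by_cases hj : x j ∈ D <;> simp [sampleMatrix, hg, hi, hj]
    · rw [if_neg hi]
      exact Finset.sum_eq_zero fun j _ => by simp [sampleMatrix, hg, hi]
  have hsi : ∀ i j, Integrable (fun x => sampleMatrix g x i j) μ := fun i j =>
    integrable_sampleMatrix ν hgi i j
  have hsum : ∫ x, ∑ i, ∑ j, sampleMatrix g x i j ∂μ =
      k * (k - 1) * ∫ z in A ×ˢ D, U z ∂(ν.prod ν) := by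
    rw [integral_finsetSum _ fun i _ => integrable_finsetSum _ fun j _ => hsi i j]
    have hcol : ∀ i, ∫ x, ∑ j, sampleMatrix g x i j ∂μ =
        ∑ j, if i = j then 0 else ∫ z, g z ∂(ν.prod ν) := fun i => by
      rw [integral_finsetSum _ fun j _ => hsi i j]
      exact Finset.sum_congr rfl fun j _ => integral_sampleMatrix ν hgi i j
    simp_rw [hcol]
    have : ∀ i : Fin k, ∑ j, (if i = j then 0 else ∫ z, g z ∂(ν.prod ν)) =
        (k - 1) * ∫ z, g z ∂(ν.prod ν) := by
      intro i
      have : ∀ j, (if i = j then 0 else ∫ z, g z ∂(ν.prod ν)) =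
          ∫ z, g z ∂(ν.prod ν) - if i = j then ∫ z, g z ∂(ν.prod ν) else 0 := fun j => by
        split_ifs <;> simp
      simp_rw [this]
      rw [Finset.sum_sub_distrib]
      simp
      ring
    simp_rw [this]
    rw [hg, integral_indicator (hA.prod hD)]
    simp
    ring
  have hti := integrable_truncCut_sampleMatrix (k := k) ν hUm hsymm hc.le
  have hbs : Integrable (fun x => 2 * ∑ i, big i x) μ :=
    (integrable_finsetSum _ fun i _ => hbigi i).const_mul 2
  have hk1 : (0 : ℝ) ≤ k * (k - 1) := by
    have : (1 : ℝ) ≤ k := by exact_mod_cast hk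
    exact mul_nonneg hk0.le (by linarith)
  have hmain : k * (k - 1) * |∫ z in A ×ˢ D, U z ∂(ν.prod ν)| ≤
      ∫ x, truncCut c (sampleMatrix U x) ∂μ + 2 * (k * (k * (N * l ^ (1 - p)))) := by
    calc k * (k - 1) * |∫ z in A ×ˢ D, U z ∂(ν.prod ν)|
        = |∫ x, ∑ i, ∑ j, sampleMatrix g x i j ∂μ| := by
          rw [hsum, abs_mul, abs_of_nonneg hk1]
      _ ≤ ∫ x, |∑ i, ∑ j, sampleMatrix g x i j| ∂μ := abs_integral_le_integral_abs
      _ ≤ ∫ x, (truncCut c (sampleMatrix U x) + 2 * ∑ i, big i x) ∂μ :=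
          integral_mono (integrable_finsetSum _ fun i _ =>
            integrable_finsetSum _ fun j _ => hsi i j).abs (hti.add hbs) hrect
      _ = ∫ x, truncCut c (sampleMatrix U x) ∂μ + 2 * ∑ i, ∫ x, big i x ∂μ := by
          rw [integral_add hti hbs, integral_const_mul, integral_finsetSum _ fun i _ => hbigi i]
      _ ≤ _ := by
          gcongr
          exact sum_le_card_mul _ (card_le_fin _) (by positivity) fun i _ => hbigint i
  linarith

end moment

/-! ### Passage to the given random variables -/

theorem exists_measurable_symmetric_ae_eq {U : unitInterval × unitInterval → ℝ}
    (hU : AEStronglyMeasurable U volume)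
    (hsymm : ∀ᵐ z : unitInterval × unitInterval, U z.swap = U z) :
    ∃ V : unitInterval × unitInterval → ℝ, Measurable V ∧ (∀ z, V z.swap = V z) ∧
      U =ᵐ[volume] V := by
  refine ⟨fun z => (hU.mk U z + hU.mk U z.swap) / 2, ?_, fun z => ?_, ?_⟩
  · have h := hU.stronglyMeasurable_mk.measurable
    exact (h.add (h.comp measurable_swap)).div_const 2
  · simp only [Prod.swap_swap, add_comm]
  · have hswap : Measure.QuasiMeasurePreserving
        (Prod.swap : unitInterval × unitInterval → unitInterval × unitInterval)
        volume volume := (Measure.measurePreserving_swap (μ := (volume : Measure unitInterval))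
          (ν := (volume : Measure unitInterval))).quasiMeasurePreserving
    filter_upwards [hU.ae_eq_mk, hswap.ae hU.ae_eq_mk, hsymm] with z h1 h2 h3
    rw [← h1, ← h2, h3]
    ring

theorem normL_nonneg (q : ℝ) (U : unitInterval × unitInterval → ℝ) : 0 ≤ normL q U :=
  ENNReal.toReal_nonneg

theorem normL_rpow {p : ℝ} (hp : 0 < p) {U : unitInterval × unitInterval → ℝ}
    (hU : MemLp U (ENNReal.ofReal p) volume) : ∫ z, |U z| ^ p = normL p U ^ p := by
  have h0 : ENNReal.ofReal p ≠ 0 := by simpa using hp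
  rw [normL, toReal_eLpNorm hU.1, lpNorm_eq_integral_norm_rpow_toReal h0 ENNReal.ofReal_ne_top hU.1,
    ENNReal.toReal_ofReal hp.le, Real.rpow_inv_rpow _ hp.ne']
  · rfl
  · exact integral_nonneg fun z => by positivity

section transfer

variable {Ω : Type*} [MeasurableSpace Ω] {P : Measure Ω} {k : ℕ}
  {X : Fin k → Ω → unitInterval}

theorem measurePreserving_sample [IsProbabilityMeasure P] (hX : ∀ i, Measurable (X i))
    (hunif : ∀ i, P.map (X i) = volume) (hindep : iIndepFun X P) :
    MeasurePreserving (fun ω i => X i ω) P (Measure.pi fun _ => volume) := by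
  refine ⟨measurable_pi_iff.2 hX, ?_⟩
  rw [(iIndepFun_iff_map_fun_eq_pi_map fun i => (hX i).aemeasurable).1 hindep]
  simp_rw [hunif]

theorem ae_cutNorm_sampleKernel (hk : 0 < k)
    (hlaw : MeasurePreserving (fun ω i => X i ω) P (Measure.pi fun _ => volume))
    {U V : unitInterval × unitInterval → ℝ} (hUV : U =ᵐ[volume] V) :
    ∀ᵐ ω ∂P, cutNorm (sampleKernel U fun i => X i ω) =
      matrixCut (sampleMatrix V fun i => X i ω) / k ^ 2 := by
  have h : ∀ i j, ∀ᵐ ω ∂P, sampleMatrix U (fun i => X i ω) i j =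
      sampleMatrix V (fun i => X i ω) i j := by
    intro i j
    unfold sampleMatrix
    split_ifs with hij
    · exact .of_forall fun _ => rfl
    · exact ((measurePreserving_eval_pair (volume : Measure unitInterval) hij).comp
        hlaw).quasiMeasurePreserving.ae hUV
  have h' := ae_all_iff.2 fun i => ae_all_iff.2 (h i)
  filter_upwards [h'] with ω hω
  rw [cutNorm_sampleKernel hk]
  congr 2
  ext i j
  exact hω i j

/-- Transfer to the given random variables. The event `G` need not be measurable; it contains, up to
a null set, the complement of the preimage of the measurable set `E`. -/
theorem one_sub_le_measureReal [IsProbabilityMeasure P]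
    (hlaw : MeasurePreserving (fun ω i => X i ω) P (Measure.pi fun _ => volume))
    {E : Set (Fin k → unitInterval)} (hE : MeasurableSet E) {b : ℝ}
    (hb : (Measure.pi fun _ => volume : Measure (Fin k → unitInterval)).real E ≤ b)
    {G : Set Ω} (hG : ∀ᵐ ω ∂P, (fun i => X i ω) ∉ E → ω ∈ G) : 1 - b ≤ P.real G := by
  have h1 : P.real ((fun ω i => X i ω) ⁻¹' E)ᶜ ≤ P.real G :=
    ENNReal.toReal_mono (measure_ne_top _ _) (measure_mono_ae hG)
  rw [probReal_compl_eq_one_sub (hlaw.measurable hE), hlaw.measureReal_preimage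
    hE.nullMeasurableSet] at h1
  linarith

end transfer

end CutSampling

end
open CutSampling MeasureTheory ProbabilityTheory in
theorem theorem1 {Ω : Type*} [MeasurableSpace Ω] (P : MeasureTheory.Measure Ω)
    [MeasureTheory.IsProbabilityMeasure P] (k : ℕ) (hk : 2 ≤ k) (p : ℝ) (hp : 2 < p)
    (U : unitInterval × unitInterval → ℝ)
    (hU : MeasureTheory.MemLp U (ENNReal.ofReal p) MeasureTheory.volume)
    (hsymm : ∀ᵐ z : unitInterval × unitInterval, U z.swap = U z)
    (X : Fin k → Ω → unitInterval) (hX : ∀ i, Measurable (X i))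
    (hunif : ∀ i, P.map (X i) = MeasureTheory.volume)
    (hindep : ProbabilityTheory.iIndepFun X P) :
    (∀ φ : ℝ, 0 < φ →
      1 - 3 * (k : ℝ) ^ (-(φ * p)) ≤
        P.real {ω | CutSampling.cutNorm (CutSampling.sampleKernel U (fun i => X i ω))
            - CutSampling.cutNorm U ≤
          (30 * CutSampling.normL p U
            + 6 * Real.sqrt (φ * p / 2) * (CutSampling.normL 1 U + 2 * CutSampling.normL p U)
              * (Real.sqrt (Real.log k) / (k : ℝ) ^ ((p - 3) / (4 * p) - φ)))
            * (k : ℝ) ^ (-(1 / 4 : ℝ) + 1 / (4 * p))}) ∧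
    (∀ γ : ℝ, 1 / p < γ → γ < 1 / 2 →
      1 - 3 * (k : ℝ) ^ (1 - γ * p) ≤
        P.real {ω | -((CutSampling.cutNorm U
              + Real.sqrt (18 * (γ * p - 1))
                * (CutSampling.normL 1 U + 2 * CutSampling.normL p U))
              * (k : ℝ) ^ (-(1 / 2 : ℝ) + γ) * Real.sqrt (Real.log k)) ≤
          CutSampling.cutNorm (CutSampling.sampleKernel U (fun i => X i ω))
            - CutSampling.cutNorm U}) := by
  have hk0 : 0 < k := by omega
  have hk2 : (2 : ℝ) ≤ k := by exact_mod_cast hk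
  have hkpos : (0 : ℝ) < k := by linarith
  have hp0 : 0 < p := by linarith
  have hp1 : 1 < p := by linarith
  have hlog : 0 < Real.log k := Real.log_pos (by linarith)
  have hlaw := measurePreserving_sample hX hunif hindep
  have hN1 := normL_nonneg 1 U
  have hN0 := normL_nonneg p U
  have hc0 := cutNorm_nonneg U
  rcases hN0.eq_or_lt with hN | hN
  · -- a kernel of norm zero vanishes almost everywhere
    have hUz : U =ᵐ[volume] 0 := by
      have h0 : ENNReal.ofReal p ≠ 0 := by simpa using hp0
      rw [← eLpNorm_eq_zero_iff hU.1 h0]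
      exact ((ENNReal.toReal_eq_zero_iff _).1 hN.symm).resolve_right hU.2.ne
    have hcU : cutNorm U = 0 := by
      rw [cutNorm_congr_ae hUz]
      exact le_antisymm (cutNorm_le fun S T _ _ => by simp) (cutNorm_nonneg _)
    have hcs : ∀ᵐ ω ∂P, cutNorm (sampleKernel U fun i => X i ω) = 0 := by
      filter_upwards [ae_cutNorm_sampleKernel hk0 hlaw hUz] with ω hω
      have h1 : (sampleMatrix 0 fun i => X i ω : Fin k → Fin k → ℝ) = 0 := by
        ext i j; simp [sampleMatrix]
      have h2 : matrixCut (0 : Fin k → Fin k → ℝ) = 0 :=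
        le_antisymm ((matrixCut_le_sum _).trans (by simp)) (matrixCut_nonneg _)
      rw [hω, h1, h2, zero_div]
    constructor
    · intro φ hφ
      refine one_sub_le_measureReal hlaw (E := ∅) .empty ?_ ?_
      · rw [measureReal_empty]; positivity
      · filter_upwards [hcs] with ω hω _
        rw [hω, hcU, sub_zero]
        positivity
    · intro γ hγ _
      refine one_sub_le_measureReal hlaw (E := ∅) .empty ?_ ?_
      · rw [measureReal_empty]; positivity
      · filter_upwards [hcs] with ω hω _
        rw [hω, hcU, sub_zero]
        exact neg_nonpos.2 (by positivity)
  obtain ⟨V, hVm, hVs, hUV⟩ := exists_measurable_symmetric_ae_eq hU.1 hsymm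
  have hV : MemLp V (ENNReal.ofReal p) volume := (memLp_congr_ae hUV).1 hU
  have hVi : Integrable V (volume.prod volume) :=
    hV.integrable (by rw [← ENNReal.ofReal_one]; exact ENNReal.ofReal_le_ofReal hp1.le)
  have hVp : Integrable (fun z => |V z| ^ p)
      ((volume : Measure unitInterval).prod volume) := by
    have := hV.integrable_norm_rpow (by simpa using hp0) ENNReal.ofReal_ne_top
    rw [ENNReal.toReal_ofReal hp0.le] at this
    exact this
  set N := normL p U with hNdef
  have hVN : ∫ z, |V z| ^ p ∂((volume : Measure unitInterval).prod volume) ≤ N ^ p := by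
    have h1 : normL p V = N := by rw [hNdef, normL, normL, eLpNorm_congr_ae hUV]
    rw [← h1]
    exact (normL_rpow hp0 hV).le
  have hcut : cutNorm U = cutNorm V := cutNorm_congr_ae hUV
  have hsample := ae_cutNorm_sampleKernel hk0 hlaw hUV
  rw [hcut] at hc0 ⊢
  have hsqrt3 : √((k : ℝ)) ^ 2 = k := Real.sq_sqrt hkpos.le
  have hsk : 0 < √(k : ℝ) := Real.sqrt_pos.2 hkpos
  -- the deviation `T` for which McDiarmid's inequality has the bound `exp (-a)`
  have hdev : ∀ a l : ℝ, 0 ≤ a → 0 < l →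
      2 * (√(2 * a) * √(k : ℝ) ^ 3 * N * l) ^ 2 / (k * (2 * (k * (N * l))) ^ 2) = a := by
    intro a l ha hl
    have h1 : (√(2 * a) * √(k : ℝ) ^ 3 * N * l) ^ 2 = 2 * a * k ^ 3 * N ^ 2 * l ^ 2 := by
      rw [mul_pow, mul_pow, mul_pow, Real.sq_sqrt (by linarith), ← pow_mul, mul_comm 3 2, pow_mul,
        hsqrt3]
    rw [h1]
    field_simp
  have hTk : ∀ a l : ℝ, √(2 * a) * √(k : ℝ) ^ 3 * N * l / k ^ 2 =
      √(2 * a) * N * l * (k : ℝ) ^ (-(1 / 2) : ℝ) := by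
    intro a l
    rw [Real.rpow_neg hkpos.le, ← Real.sqrt_eq_rpow]
    nth_rw 2 [← hsqrt3]
    field_simp
  constructor
  · intro φ hφ
    set l : ℝ := (k : ℝ) ^ (φ + 1 / p) with hl
    have hl0 : 0 < l := by positivity
    set a : ℝ := φ * p * Real.log k with ha
    have ha0 : 0 ≤ a := by positivity
    have htail := measureReal_matrixCut_ge_le volume hk0 hp1 hVm hVi hVs hVp hVN hN hl0
      (T := √(2 * a) * √(k : ℝ) ^ 3 * N * l) (by positivity)
    rw [hdev a l ha0 hl0] at htail
    have hr1 : k * l ^ (-p) = (k : ℝ) ^ (-(φ * p)) := by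
      rw [hl, ← Real.rpow_mul hkpos.le]
      nth_rw 1 [← Real.rpow_one (k : ℝ)]
      rw [← Real.rpow_add hkpos]
      congr 1
      field_simp
      ring
    have hr2 : Real.exp (-a) = (k : ℝ) ^ (-(φ * p)) := by
      rw [Real.rpow_def_of_pos hkpos, ha]; ring_nf
    rw [hr1, hr2] at htail
    refine one_sub_le_measureReal hlaw ?_ (b := 3 * (k : ℝ) ^ (-(φ * p)))
      (htail.trans (by linarith [Real.rpow_pos_of_pos hkpos (-(φ * p))])) ?_
    · exact measurableSet_le measurable_const (measurable_matrixCut_sampleMatrix hVm)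
    · have hmean := integral_matrixCut_le volume hk0 hVm hVi hp1 hN hVp hVN (κ := cutNorm V)
        fun A D hA hD => abs_setIntegral_le_cutNorm hVi hA hD
      filter_upwards [hsample] with ω hω hnot
      simp only [not_le] at hnot ⊢
      rw [hω]
      have h1 : matrixCut (sampleMatrix V fun i => X i ω) / k ^ 2 ≤
          cutNorm V + 13 * N * (k : ℝ) ^ (-(1 / 4 : ℝ) + 1 / (4 * p)) +
            √(2 * a) * N * l * (k : ℝ) ^ (-(1 / 2) : ℝ) := by
        rw [← hTk a l, div_le_iff₀ (by positivity), add_mul,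
          div_mul_cancel₀ _ (by positivity)]
        linarith
      have h2 : √(2 * a) = 2 * √(φ * p / 2) * √(Real.log k) := by
        rw [ha, show 2 * (φ * p * Real.log k) = 2 ^ 2 * (φ * p / 2) * Real.log k by ring,
          Real.sqrt_mul (by positivity), Real.sqrt_mul (by positivity),
          Real.sqrt_sq (by norm_num)]
      have h3 : l * (k : ℝ) ^ (-(1 / 2) : ℝ) = (k : ℝ) ^ (-(1 / 4 : ℝ) + 1 / (4 * p)) /
          (k : ℝ) ^ ((p - 3) / (4 * p) - φ) := by
        rw [hl, ← Real.rpow_add hkpos, ← Real.rpow_sub hkpos]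
        congr 1
        field_simp
        ring
      set e := (k : ℝ) ^ (-(1 / 4 : ℝ) + 1 / (4 * p))
      set d := (k : ℝ) ^ ((p - 3) / (4 * p) - φ)
      have he : 0 < e := by positivity
      have hd : 0 < d := by positivity
      have h4 : √(2 * a) * N * l * (k : ℝ) ^ (-(1 / 2) : ℝ) =
          2 * √(φ * p / 2) * N * (√(Real.log k) / d) * e := by
        rw [mul_assoc _ l, h3, h2]; ring
      rw [h4] at h1
      have h5 : 0 ≤ √(φ * p / 2) * (√(Real.log k) / d) * e := by positivity
      have h6 : 0 ≤ √(φ * p / 2) * (√(Real.log k) / d) * e * N := by positivity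
      have h7 : 0 ≤ √(φ * p / 2) * (√(Real.log k) / d) * e * normL 1 U := by positivity
      have h8 : 0 ≤ N * e := by positivity
      nlinarith
  · intro γ hγ _
    by_cases hr : 1 ≤ 3 * (k : ℝ) ^ (1 - γ * p)
    · exact (sub_nonpos.2 hr).trans measureReal_nonneg
    push Not at hr
    have hγ0 : 0 < γ := lt_trans (by positivity) hγ
    have hγp : 1 < γ * p := by rwa [div_lt_iff₀ hp0] at hγ
    set l : ℝ := (k : ℝ) ^ γ with hl
    have hl0 : 0 < l := by positivity
    have hl1 : 1 ≤ l := Real.one_le_rpow (by linarith) hγ0.le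
    set a : ℝ := (γ * p - 1) * Real.log k with ha
    have ha0 : 0 ≤ a := mul_nonneg (by linarith) hlog.le
    have hr2 : Real.exp (-a) = (k : ℝ) ^ (1 - γ * p) := by
      rw [Real.rpow_def_of_pos hkpos, ha]; ring_nf
    -- the claim is void unless the bound on the failure probability is less than `1`
    have ha1 : 1 ≤ a := by
      by_contra! h
      have h1 : Real.exp (-1) < Real.exp (-a) := Real.exp_lt_exp.2 (by linarith)
      have h2 : Real.exp 1 < 3 := by linarith [Real.exp_one_lt_d9]
      have h3 : 1 / 3 < Real.exp (-1) := by
        rw [Real.exp_neg, ← one_div]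
        exact one_div_lt_one_div_of_lt (Real.exp_pos 1) h2
      rw [← hr2] at hr
      linarith
    have htail := measureReal_matrixCut_le_le volume hk0 hVm hVs (c := k * (N * l))
      (by positivity) (T := √(2 * a) * √(k : ℝ) ^ 3 * N * l) (by positivity)
    rw [hdev a l ha0 hl0, hr2] at htail
    refine one_sub_le_measureReal hlaw ?_ (b := 3 * (k : ℝ) ^ (1 - γ * p))
      (htail.trans (by linarith [Real.rpow_pos_of_pos hkpos (1 - γ * p)])) ?_
    · exact measurableSet_le (measurable_matrixCut_sampleMatrix hVm) measurable_const
    · set m := ∫ x, truncCut (k * (N * l)) (sampleMatrix V x)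
        ∂(Measure.pi fun _ : Fin k => (volume : Measure unitInterval)) with hm
      have hmean : k * (k - 1) * cutNorm V - 2 * k ^ 2 * N * l ^ (1 - p) ≤ m := by
        have hkk : (0 : ℝ) < k * (k - 1) := mul_pos hkpos (by linarith)
        have : cutNorm V ≤ (m + 2 * k ^ 2 * N * l ^ (1 - p)) / (k * (k - 1)) := by
          refine cutNorm_le fun A D hA hD => ?_
          rw [le_div_iff₀ hkk]
          have := le_integral_truncCut volume hk0 hp1 hVm hVi hVs hVp hVN hN hl0 hA hD
          rw [← Measure.volume_eq_prod] at this
          linarith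
        rw [le_div_iff₀ hkk] at this
        linarith
      filter_upwards [hsample] with ω hω hnot
      simp only [not_le] at hnot ⊢
      rw [hω]
      set h := (k : ℝ) ^ (-(1 / 2) : ℝ) with hh
      have hh0 : 0 < h := by positivity
      have h1 : cutNorm V - cutNorm V / k - 2 * N * l ^ (1 - p) - √(2 * a) * N * l * h ≤
          matrixCut (sampleMatrix V fun i => X i ω) / k ^ 2 := by
        rw [← hTk a l, le_div_iff₀ (by positivity), sub_mul, sub_mul, sub_mul,
          div_mul_cancel₀ _ (by positivity)]
        have : cutNorm V / k * k ^ 2 = k * cutNorm V := by field_simp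
        rw [this]
        linarith
      have hkinv : (k : ℝ)⁻¹ ≤ h := by
        rw [← Real.rpow_neg_one, hh]
        exact Real.rpow_le_rpow_of_exponent_le (by linarith) (by norm_num)
      have h2 : l ^ (1 - p) ≤ l * h := by
        rw [sub_eq_add_neg, Real.rpow_add hl0, Real.rpow_one]
        gcongr
        refine le_trans ?_ hkinv
        rw [hl, ← Real.rpow_mul hkpos.le, ← Real.rpow_neg_one]
        exact Real.rpow_le_rpow_of_exponent_le (by linarith) (by linarith)
      have h3 : (k : ℝ) ^ (-(1 / 2 : ℝ) + γ) = h * l := Real.rpow_add hkpos _ _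
      have h4 : √(18 * (γ * p - 1)) * √(Real.log k) = 3 * √(2 * a) := by
        rw [← Real.sqrt_mul (by linarith), show 18 * (γ * p - 1) * Real.log k = 3 ^ 2 * (2 * a) by
          rw [ha]; ring, Real.sqrt_mul (by positivity), Real.sqrt_sq (by norm_num)]
      have h5 : 1 ≤ √(2 * a) := Real.one_le_sqrt.2 (by linarith)
      have h6 : cutNorm V / k ≤ cutNorm V * (h * l * √(Real.log k)) := by
        rw [div_eq_mul_inv]
        gcongr
        have hinv : (k : ℝ)⁻¹ = h * h := by
          rw [hh, ← Real.rpow_add hkpos, ← Real.rpow_neg_one]; norm_num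
        have hlog2 : h ≤ √(Real.log k) := by
          refine Real.le_sqrt_of_sq_le ?_
          rw [sq, ← hinv]
          have hl2 := Real.log_two_gt_d9
          have : Real.log 2 ≤ Real.log k := Real.log_le_log (by norm_num) hk2
          have : (k : ℝ)⁻¹ ≤ 2⁻¹ := inv_anti₀ (by norm_num) hk2
          linarith
        rw [hinv]
        calc h * h ≤ h * √(Real.log k) := by gcongr
          _ ≤ h * l * √(Real.log k) := by
            gcongr
            exact le_mul_of_one_le_right hh0.le hl1
      rw [h3]
      have e : (cutNorm V + √(18 * (γ * p - 1)) * (normL 1 U + 2 * N)) * (h * l) *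
          √(Real.log k) = cutNorm V * (h * l * √(Real.log k)) +
            (√(18 * (γ * p - 1)) * √(Real.log k)) * (normL 1 U + 2 * N) * (h * l) := by ring
      rw [e, h4]
      have h7 : 2 * N * l ^ (1 - p) ≤ 2 * (N * (h * l)) := by
        calc 2 * N * l ^ (1 - p) ≤ 2 * N * (l * h) := by gcongr
          _ = _ := by ring
      have h8 : N * (h * l) ≤ √(2 * a) * (N * (h * l)) :=
        le_mul_of_one_le_left (by positivity) h5
      have h9 : 0 ≤ √(2 * a) * normL 1 U * (h * l) := by positivity
      have h10 : 0 ≤ √(2 * a) * (N * (h * l)) := by positivity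
      linarith
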